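/- Let $K$ be a separably closed field of characteristic $p>0$ with algebraic closure $\overline K$, let $C$ be a geometrically integral curve over $K$ (a separated, geometrically integral $K$-scheme of finite type of dimension $1$), and let $P\in C$ be a closed point at which $C$ is regular, with local ring $\mathcal O_{C,P}$ and residue field $\mathbf k(C,P)$. Let $\overline K\mathcal O_{C,P}=\overline K\otimes_K\mathcal O_{C,P}$, which is a domain, and let $\widetilde{\mathcal O}$ be its integral closure in its field of fractions, which is a discrete valuation ring, with normalized valuation $\nu_0$. Put $\Gamma=\{\nu_0(x) : 0\neq x\in\overline K\mathcal O_{C,P}\}$, a semigroup with only finitely many gaps in $\mathbb Z_{\ge 0}$. Let the conductor $c(C,P)$ be the largest positive integer $c\in\Gamma$ such that $c-1\notin\Gamma$, with $c(C,P)=0$ if $\Gamma=\mathbb Z_{\ge 0}$. Let the differential degree be $d(C,P)=1+\dim_{\overline K}\operatorname{Coker}(\alpha)$, where $$\alpha\colon \widetilde{\mathcal O}\otimes_{\overline K\mathcal O_{C,P}}\Omega_{\overline K\mathcal O_{C,P}/\overline K}\to\Omega_{\widetilde{\mathcal O}/\overline K}$$ is the natural map; this cokernel is finite-dimensional. Then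 $[\mathbf k(C,P):K]$ is finite and $$[\mathbf k(C,P):K]\ \text{ divides }\ c(C,P)+d(C,P)-1 .$$ -/

import Mathlib

open AlgebraicGeometry CategoryTheory
open scoped TensorProduct

universe u

noncomputable section

namespace RegularCurve

/-! ### The local ring of a `K`-scheme at a point, as a `K`-algebra -/

section LocalRing

variable {K : Type u} [Field K] {C : Scheme.{u}}

/-- The local ring `𝒪_{C,P}` of a `K`-scheme `f : C ⟶ Spec K` at a point `P`. -/
def LocalRing (_f : C ⟶ Spec (.of K)) (P : C) : Type u := C.presheaf.stalk P

variable (f : C ⟶ Spec (.of K)) (P : C)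

instance : CommRing (LocalRing f P) := inferInstanceAs (CommRing (C.presheaf.stalk P))

instance : IsLocalRing (LocalRing f P) := inferInstanceAs (IsLocalRing (C.presheaf.stalk P))

/-- The structure map `K → Γ(C, 𝒪_C) → 𝒪_{C,P}`. -/
def structureMap : K →+* C.presheaf.stalk P :=
  ((Scheme.ΓSpecIso (.of K)).inv ≫ f.appTop ≫ C.presheaf.germ ⊤ P trivial).hom

instance : Algebra K (LocalRing f P) := (structureMap f P).toAlgebra

/-- The degree `[k(C,P) : K]` of a point. -/
def pointDegree : ℕ := Module.finrank K (IsLocalRing.ResidueField (LocalRing f P))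

end LocalRing

/-! ### Differential degree and conductor of a ring extension

These are applied to `k = K̄`, `A = K̄𝒪_{C,P}` and `B` the normalization of `A`. -/

section Invariants

section Differentials

variable (k A B : Type u) [Field k] [CommRing A] [CommRing B] [Algebra k A] [Algebra A B]
  [Algebra k B] [IsScalarTower k A B]

/-- The cokernel of the natural map `α : B ⊗_A Ω_{A/k} → Ω_{B/k}`. -/
abbrev CokerAlpha : Type u :=
  Ω[B⁄k] ⧸ LinearMap.range (KaehlerDifferential.mapBaseChange k A B)

/-- The differential degree `1 + dim_k Coker α`. -/
def diffDegree : ℕ := 1 + Module.finrank k (CokerAlpha k A B)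

end Differentials

section Semigroup

variable (A B : Type u) [CommRing A] [CommRing B] [Algebra A B] [IsDomain B]
  [IsDiscreteValuationRing B]

/-- The semigroup of the values `ν(x)` of the nonzero `x ∈ A`, where `ν` is the normalized discrete
valuation with valuation ring `B`. (The element `0` has value `⊤` and contributes nothing.) -/
def valueSemigroup : Set ℕ :=
  {l | ∃ x : A, IsDiscreteValuationRing.addVal B (algebraMap A B x) = (l : ℕ∞)}

/-- The conductor of a semigroup `Γ` of natural numbers with finitely many gaps: the largest
positive `c ∈ Γ` such that `c - 1` is a gap, and `0` if there is no such `c` (that is, `Γ = ℕ`). -/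
def semigroupConductor (Γ : Set ℕ) : ℕ := sSup {c | 0 < c ∧ c ∈ Γ ∧ c - 1 ∉ Γ}

/-- The conductor of the value semigroup of `A`. -/
def conductor : ℕ := semigroupConductor (valueSemigroup A B)

end Semigroup

end Invariants

/-! ### The local rings over the algebraic closure

Here `R` stands for the local ring `𝒪_{C,P}`, regarded as a `K`-algebra. -/

section Geometric

variable (K : Type u) [Field K] (R : Type u) [CommRing R] [Algebra K R]

/-- The extended ring `K̄R = K̄ ⊗_K R`: for `K` separably closed and `R = 𝒪_{C,P}` this is the
local ring of `C ×_K K̄` at the unique point over `P`. -/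
abbrev GeomRing : Type u := AlgebraicClosure K ⊗[K] R

/-- The normalization of `K̄R`, that is, its integral closure in its ring of fractions. -/
abbrev GeomNormalization : Type u := integralClosure (GeomRing K R) (FractionRing (GeomRing K R))

end Geometric

end RegularCurve

end

/-!
Write `R = 𝒪_{C,P}`, `A = K̄ ⊗ R`, and let `B` be the normalization of `A`, with valuation `ν` on
the fraction field `E`. As `K̄ / K` is purely inseparable, every element of `A` has a `p ^ n`-th
power in `R`, so `B` is again a discrete valuation ring, and a uniformizer of `R` has `ν`-value
`[k(P) : K]`, the colength over `K̄` of the ideal it generates in `A`. It therefore suffices to find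
one `r ∈ R` with `ν r = c + d - 1`.

Let `D` be the derivation `d/dt` of `E`, for `t` a uniformizer of `B`. The rings `A_n` spanned over
`K̄` by the valuation rings of the fields `L_n = (Frac R) ^ (1 / p ^ n)` increase from `A` to `B`.
The valuation ring of `L_n` is generated over its elements that are `p`-th powers in `E` by a single
element `η_n`, and `d_n - 1 = ν (D η_n)`. Duality with respect to the coefficient of
`η_n ^ (p - 1)` gives `c_n = (p - 1) ν (D η_n) + p c_{n+1}` for the conductors. Hence, if
`r_{n+1} ∈ L_{n+1}` has value `c_{n+1} + d_{n+1} - 1`, then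
`r_n = (r_{n+1} * D η_n / D η_{n+1}) ^ p` is an element of `L_n` of value `c_n + d_n - 1`.
-/

namespace RegularCurve

section Order

open scoped WithZero

variable {E : Type*} [Field E] (v : Valuation E ℤᵐ⁰)

/-- The order of an element with respect to a `ℤ`-valued valuation, written additively. The order
of `0` is the junk value `0`. -/
def ord (x : E) : ℤ := -WithZero.log (v x)

/-- The additive subgroup of the elements of order at least `n`, among them `0`. -/
def ordGE (n : ℤ) : AddSubgroup E := v.leAddSubgroup (WithZero.exp (-n))

variable {v}

theorem mem_ordGE {n : ℤ} {x : E} : x ∈ ordGE v n ↔ (x ≠ 0 → n ≤ ord v x) := by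
  rcases eq_or_ne x 0 with rfl | hx
  · simp
  · have hvx := (v.ne_zero_iff).mpr hx
    simp only [ordGE, Valuation.mem_leAddSubgroup_iff, ord, le_neg,
      ← WithZero.log_le_iff_le_exp hvx,
      forall_prop_of_true hx]

theorem mem_ordGE_of_le {n : ℤ} {x : E} (h : n ≤ ord v x) : x ∈ ordGE v n :=
  mem_ordGE.mpr fun _ ↦ h

theorem le_ord_of_mem {n : ℤ} {x : E} (hx : x ∈ ordGE v n) (h0 : x ≠ 0) : n ≤ ord v x :=
  mem_ordGE.mp hx h0

theorem mem_ordGE_zero {x : E} : x ∈ ordGE v 0 ↔ x ∈ v.integer := by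
  simp [ordGE, Valuation.mem_integer_iff]

theorem ordGE_anti {m n : ℤ} (h : m ≤ n) : ordGE v n ≤ ordGE v m :=
  v.leAddSubgroup_monotone (WithZero.exp_le_exp.mpr (neg_le_neg h))

theorem ord_mul {x y : E} (hx : x ≠ 0) (hy : y ≠ 0) : ord v (x * y) = ord v x + ord v y := by
  rw [ord, map_mul, WithZero.log_mul (v.ne_zero_iff.mpr hx) (v.ne_zero_iff.mpr hy), neg_add, ord,
    ord]

theorem ord_one : ord v 1 = 0 := by simp [ord]

theorem ord_inv (x : E) : ord v x⁻¹ = -ord v x := by rw [ord, map_inv₀, WithZero.log_inv, ord]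

theorem ord_pow (x : E) (n : ℕ) : ord v (x ^ n) = n * ord v x := by
  simp [ord, WithZero.log_pow]

theorem ord_zpow (x : E) (n : ℤ) : ord v (x ^ n) = n * ord v x := by
  simp [ord, WithZero.log_zpow]

theorem mul_mem_ordGE {m n : ℤ} {x y : E} (hx : x ∈ ordGE v m) (hy : y ∈ ordGE v n) :
    x * y ∈ ordGE v (m + n) := by
  rw [ordGE, Valuation.mem_leAddSubgroup_iff] at *
  rw [map_mul, neg_add, WithZero.exp_add]
  exact mul_le_mul' hx hy

theorem integer_mul_mem_ordGE {n : ℤ} {x y : E} (hx : x ∈ v.integer) (hy : y ∈ ordGE v n) :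
    x * y ∈ ordGE v n := by
  simpa using mul_mem_ordGE (mem_ordGE_zero.mpr hx) hy

theorem ord_add_of_mem {x y : E} (hx : x ≠ 0) (hy : y ∈ ordGE v (ord v x + 1)) :
    x + y ≠ 0 ∧ ord v (x + y) = ord v x := by
  have hvx := v.ne_zero_iff.mpr hx
  have hlt : v y < v x := by
    refine lt_of_le_of_lt hy ?_
    rw [← WithZero.lt_log_iff_exp_lt hvx, ord]
    omega
  have hadd : v (x + y) = v x := v.map_add_eq_of_lt_left hlt
  exact ⟨v.ne_zero_iff.mp (hadd ▸ hvx), by rw [ord, hadd, ord]⟩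

section Sum

variable {ι : Type*} {s : Finset ι} {f : ι → E}

theorem exists_ord_sum_eq
    (hd : ∀ i ∈ s, ∀ j ∈ s, f i ≠ 0 → f j ≠ 0 → ord v (f i) = ord v (f j) → i = j)
    (hne : ∃ i ∈ s, f i ≠ 0) :
    ∃ i ∈ s, f i ≠ 0 ∧ ∑ j ∈ s, f j ≠ 0 ∧ ord v (∑ j ∈ s, f j) = ord v (f i) ∧
      ∀ j ∈ s, f j ∈ ordGE v (ord v (f i)) := by
  classical
  obtain ⟨i₀, hi₀, hi₀'⟩ := hne
  obtain ⟨i, hi, hmin⟩ := Finset.exists_min_image (s.filter fun i ↦ f i ≠ 0) (fun i ↦ ord v (f i))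
    ⟨i₀, by simp [hi₀, hi₀']⟩
  simp only [Finset.mem_filter] at hi hmin
  have hrest : ∑ j ∈ s.erase i, f j ∈ ordGE v (ord v (f i) + 1) := by
    refine sum_mem fun j hj ↦ mem_ordGE.mpr fun h0 ↦ ?_
    rw [Finset.mem_erase] at hj
    have hle := hmin j ⟨hj.2, h0⟩
    have hord : ord v (f i) ≠ ord v (f j) := fun h ↦ hj.1 (hd i hi.1 j hj.2 hi.2 h0 h).symm
    omega
  obtain ⟨hsum, hord⟩ := ord_add_of_mem hi.2 hrest
  rw [Finset.add_sum_erase s f hi.1] at hsum hord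
  exact ⟨i, hi.1, hi.2, hsum, hord, fun j hj ↦ mem_ordGE.mpr fun h0 ↦ hmin j ⟨hj, h0⟩⟩

theorem mem_ordGE_of_sum_mem
    (hd : ∀ i ∈ s, ∀ j ∈ s, f i ≠ 0 → f j ≠ 0 → ord v (f i) = ord v (f j) → i = j) {n : ℤ}
    (hs : ∑ j ∈ s, f j ∈ ordGE v n) {j : ι} (hj : j ∈ s) : f j ∈ ordGE v n := by
  by_cases h0 : f j = 0
  · exact h0 ▸ zero_mem _
  obtain ⟨i, -, -, hne, hord, hmin⟩ := exists_ord_sum_eq hd ⟨j, hj, h0⟩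
  exact ordGE_anti (hord ▸ le_ord_of_mem hs hne) (hmin j hj)

end Sum

end Order

section Frobenius

variable (E : Type*) [Field E] (p : ℕ) [Fact p.Prime] [CharP E p]

/-- The subfield `E ^ p` of the `p`-th powers. -/
abbrev powField : Subfield E := (frobenius E p).fieldRange

variable {E}

theorem mem_powField {x : E} : x ∈ powField E p ↔ ∃ y, y ^ p = x := by
  simp [powField, frobenius_def]

theorem pow_mem_powField (x : E) : x ^ p ∈ powField E p := (mem_powField p).mpr ⟨x, rfl⟩

variable {p}

theorem natDegree_minpoly_of_notMem_powField (hfr : Module.finrank (powField E p) E = p) {η : E}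
    (hη : η ∉ powField E p) : (minpoly (powField E p) η).natDegree = p := by
  have hp := Fact.out (p := p.Prime)
  have hfd : FiniteDimensional (powField E p) E :=
    FiniteDimensional.of_finrank_pos (by rw [hfr]; exact hp.pos)
  have hdvd := minpoly.degree_dvd (K := powField E p) (Algebra.IsIntegral.isIntegral η)
  rw [hfr] at hdvd
  refine ((Nat.dvd_prime hp).mp hdvd).resolve_left fun h1 ↦ hη ?_
  obtain ⟨y, rfl⟩ := minpoly.natDegree_eq_one_iff.mp h1
  exact y.2

theorem minpoly_of_notMem_powField (hfr : Module.finrank (powField E p) E = p) {η : E}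
    (hη : η ∉ powField E p) : minpoly (powField E p) η =
      Polynomial.X ^ p - Polynomial.C ⟨η ^ p, pow_mem_powField p η⟩ := by
  have hp := (Fact.out : p.Prime)
  have : FiniteDimensional (powField E p) E :=
    FiniteDimensional.of_finrank_pos (by rw [hfr]; exact hp.pos)
  refine (Polynomial.eq_of_monic_of_dvd_of_natDegree_le
    (minpoly.monic (Algebra.IsIntegral.isIntegral η))
    (Polynomial.monic_X_pow_sub_C _ hp.ne_zero) (minpoly.dvd _ η ?_) ?_).symm
  · simp [Algebra.algebraMap_eq_smul_one, Subfield.smul_def]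
  · rw [Polynomial.natDegree_X_pow_sub_C, natDegree_minpoly_of_notMem_powField hfr hη]

theorem exists_pow_basis (hfr : Module.finrank (powField E p) E = p) {η : E}
    (hη : η ∉ powField E p) :
    ∃ b : Module.Basis (Fin p) (powField E p) E, ∀ i, b i = η ^ (i : ℕ) := by
  have hli := linearIndependent_pow (K := powField E p) η
  rw [natDegree_minpoly_of_notMem_powField hfr hη] at hli
  have : Nonempty (Fin p) := ⟨⟨0, (Fact.out : p.Prime).pos⟩⟩
  exact ⟨basisOfLinearIndependentOfCardEqFinrank hli (by simp [hfr]), by simp⟩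

theorem exists_eq_sum_mul_pow (hfr : Module.finrank (powField E p) E = p) {η : E}
    (hη : η ∉ powField E p) (x : E) :
    ∃ u : ℕ → E, (∀ a, u a ∈ powField E p) ∧ x = ∑ a ∈ Finset.range p, u a * η ^ a := by
  obtain ⟨b, hb⟩ := exists_pow_basis hfr hη
  refine ⟨fun a ↦ if h : a < p then b.repr x ⟨a, h⟩ else 0, fun a ↦ ?_, ?_⟩
  · dsimp only
    split_ifs
    exacts [Subtype.prop _, zero_mem _]
  · conv_lhs => rw [← b.sum_repr x]
    rw [Finset.sum_range]
    refine Finset.sum_congr rfl fun i _ ↦ ?_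
    simp [hb, Subfield.smul_def]

theorem map_powField_mul (T : E →ₗ[powField E p] E) {u : E} (hu : u ∈ powField E p) (x : E) :
    T (u * x) = u * T x := T.map_smul (⟨u, hu⟩ : powField E p) x

theorem derivation_powField_mul (D : Derivation (powField E p) E E) {u : E}
    (hu : u ∈ powField E p) (x : E) : D (u * x) = u * D x := map_powField_mul D.toLinearMap hu x

theorem derivation_powField (D : Derivation (powField E p) E E) {u : E} (hu : u ∈ powField E p) :
    D u = 0 := D.map_algebraMap (⟨u, hu⟩ : powField E p)

/-- The derivative of polynomials descends along evaluation at `t`: the minimal polynomial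
`X ^ p - t ^ p` has derivative zero. -/
theorem exists_derivation_apply_eq_one (hfr : Module.finrank (powField E p) E = p) {t : E}
    (ht : t ∉ powField E p) : ∃ D : Derivation (powField E p) E E, D t = 1 := by
  obtain ⟨b, hb⟩ := exists_pow_basis hfr ht
  have hsurj : Function.Surjective (Polynomial.aeval (R := powField E p) t) := fun x ↦ by
    rw [← b.sum_repr x]
    exact ⟨∑ i, b.repr x i • Polynomial.X ^ (i : ℕ), by simp [hb]⟩
  have hker (f : Polynomial (powField E p)) (hf : Polynomial.aeval t f = 0) :
      Polynomial.aeval t (Polynomial.derivative' f) = 0 := by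
    obtain ⟨g, rfl⟩ := minpoly.dvd _ t hf
    have hpow : Polynomial.derivative (Polynomial.X ^ p : Polynomial (powField E p)) = 0 := by
      simp [Polynomial.derivative_X_pow]
    rw [map_mul, minpoly.aeval, zero_mul] at hf
    simp [minpoly_of_notMem_powField hfr ht, hpow,
      Algebra.algebraMap_eq_smul_one, Subfield.smul_def]
  exact ⟨Derivation.liftOfSurjective hsurj hker, by
    simpa using Derivation.liftOfSurjective_apply hsurj hker Polynomial.X⟩

end Frobenius

section CurveValuation

open scoped WithZero

variable {E : Type*} [Field E] {v : Valuation E ℤᵐ⁰} {p : ℕ} [Fact p.Prime]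

theorem eq_of_ord_mul_pow_eq {e m : ℤ} (he : e ≠ 0) (hm : ¬ (p : ℤ) ∣ m) {x : E}
    (hxe : ord v x = e * m) {u : ℕ → E} (hu : ∀ a < p, u a ≠ 0 → (p : ℤ) * e ∣ ord v (u a)) :
    ∀ i ∈ Finset.range p, ∀ j ∈ Finset.range p, u i * x ^ i ≠ 0 → u j * x ^ j ≠ 0 →
      ord v (u i * x ^ i) = ord v (u j * x ^ j) → i = j := by
  intro i hi j hj hi0 hj0 hij
  rw [Finset.mem_range] at hi hj
  rw [ord_mul (left_ne_zero_of_mul hi0) (right_ne_zero_of_mul hi0),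
    ord_mul (left_ne_zero_of_mul hj0) (right_ne_zero_of_mul hj0), ord_pow, ord_pow, hxe] at hij
  obtain ⟨a, ha⟩ := hu i hi (left_ne_zero_of_mul hi0)
  obtain ⟨b, hb⟩ := hu j hj (left_ne_zero_of_mul hj0)
  rw [ha, hb] at hij
  have hdvd : (p : ℤ) ∣ ((i : ℤ) - j) * m :=
    ⟨b - a, mul_left_cancel₀ he (by linear_combination hij)⟩
  have hdvd' :=
    ((Nat.prime_iff_prime_int.mp (Fact.out : p.Prime)).dvd_mul.mp hdvd).resolve_right hm
  have hzero := Int.eq_zero_of_abs_lt_dvd hdvd' (by rw [abs_lt]; omega)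
  omega

variable [CharP E p]

theorem dvd_ord_of_mem_powField {x : E} (hx : x ∈ powField E p) : (p : ℤ) ∣ ord v x := by
  obtain ⟨y, rfl⟩ := (mem_powField p).mp hx
  exact ⟨ord v y, ord_pow y p⟩

theorem eq_of_ord_mul_pow_eq_of_mem_powField {x : E} (hpx : ¬ (p : ℤ) ∣ ord v x)
    {u : ℕ → E} (hu : ∀ a, u a ∈ powField E p) :
    ∀ i ∈ Finset.range p, ∀ j ∈ Finset.range p, u i * x ^ i ≠ 0 → u j * x ^ j ≠ 0 →
      ord v (u i * x ^ i) = ord v (u j * x ^ j) → i = j :=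
  eq_of_ord_mul_pow_eq one_ne_zero hpx (one_mul _).symm fun a _ _ ↦ by
    rw [mul_one]
    exact dvd_ord_of_mem_powField (hu a)

variable (p) in
/-- `v` is the normalized valuation of a discrete valuation ring of the function field `E` of a
curve over a perfect field `k` of characteristic `p`, with residue field `k` and uniformizer `t`.
Of the function field only the consequence `[E : E ^ p] ≤ p` is recorded. -/
structure IsCurveVal (v : Valuation E ℤᵐ⁰) (k : Subfield E) (t : E) : Prop where
  ord_t : ord v t = 1
  mem_integer : ∀ c ∈ k, c ∈ v.integer
  exists_root : ∀ c ∈ k, ∃ d ∈ k, d ^ p = c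
  exists_residue : ∀ x ∈ v.integer, ∃ c ∈ k, x - c ∈ ordGE v 1
  finite : Module.Finite (powField E p) E
  finrank_le : Module.finrank (powField E p) E ≤ p

namespace IsCurveVal

variable {k : Subfield E} {t : E} (h : IsCurveVal p v k t)
include h

theorem t_ne_zero : t ≠ 0 := by
  rintro rfl
  simpa [ord] using h.ord_t

theorem ord_eq_zero {c : E} (hc : c ∈ k) : ord v c = 0 := by
  rcases eq_or_ne c 0 with rfl | h0
  · simp [ord]
  have hle := le_ord_of_mem (mem_ordGE_zero.mpr (h.mem_integer c hc)) h0
  have hge := le_ord_of_mem (mem_ordGE_zero.mpr (h.mem_integer _ (inv_mem hc))) (inv_ne_zero h0)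
  rw [ord_inv] at hge
  omega

theorem mem_powField_of_mem {c : E} (hc : c ∈ k) : c ∈ powField E p := by
  obtain ⟨d, -, rfl⟩ := h.exists_root c hc
  exact pow_mem_powField p d

theorem not_dvd_ord_t : ¬ (p : ℤ) ∣ ord v t := by
  rw [h.ord_t]
  exact_mod_cast (Fact.out : p.Prime).one_lt.ne' ∘ Nat.dvd_one.mp

theorem t_notMem_powField : t ∉ powField E p := fun ht ↦
  h.not_dvd_ord_t (dvd_ord_of_mem_powField ht)

theorem linearIndependent_pow_t :
    LinearIndependent (powField E p) fun i : Fin p ↦ t ^ (i : ℕ) := by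
  rw [Fintype.linearIndependent_iff]
  intro g hg i
  by_contra hi
  let u : ℕ → E := fun a ↦ if ha : a < p then g ⟨a, ha⟩ else 0
  have hu (a : ℕ) : u a ∈ powField E p := by
    dsimp only [u]
    split_ifs
    exacts [Subtype.prop _, zero_mem _]
  have hui (i : Fin p) : u i = g i := dif_pos i.2
  obtain ⟨-, -, -, hne, -⟩ := exists_ord_sum_eq (f := fun a ↦ u a * t ^ a)
    (eq_of_ord_mul_pow_eq_of_mem_powField h.not_dvd_ord_t hu)
    ⟨i, Finset.mem_range.mpr i.2, by simpa [hui, h.t_ne_zero] using hi⟩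
  apply hne
  rw [Finset.sum_range, ← hg]
  exact Finset.sum_congr rfl fun j _ ↦ by rw [hui, Subfield.smul_def, smul_eq_mul]

theorem finrank_powField : Module.finrank (powField E p) E = p := by
  have := h.finite
  exact le_antisymm h.finrank_le (by simpa using h.linearIndependent_pow_t.fintype_card_le_finrank)

theorem exists_eq_sum_mul_pow_t {s : ℤ} {x : E} (hx : x ∈ ordGE v s) :
    ∃ u : ℕ → E, (∀ a, u a ∈ powField E p) ∧ x = ∑ a ∈ Finset.range p, u a * t ^ a ∧
      ∀ a < p, u a * t ^ a ∈ ordGE v s := by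
  obtain ⟨u, hu, rfl⟩ := exists_eq_sum_mul_pow h.finrank_powField h.t_notMem_powField x
  exact ⟨u, hu, rfl, fun a ha ↦ mem_ordGE_of_sum_mem
    (eq_of_ord_mul_pow_eq_of_mem_powField h.not_dvd_ord_t hu) hx
    (Finset.mem_range.mpr ha)⟩

theorem exists_not_dvd_ord_sub {η : E} (hη : η ∉ powField E p) :
    ∃ w ∈ powField E p, ¬ (p : ℤ) ∣ ord v (η - w) := by
  obtain ⟨u, hu, hsum⟩ := exists_eq_sum_mul_pow h.finrank_powField h.t_notMem_powField η
  have h0 : 0 ∈ Finset.range p := by simpa using (Fact.out : p.Prime).pos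
  have hsub : η - u 0 = ∑ a ∈ (Finset.range p).erase 0, u a * t ^ a := by
    rw [hsum, ← Finset.add_sum_erase _ _ h0, pow_zero, mul_one, add_sub_cancel_left]
  have hne : ∃ a ∈ (Finset.range p).erase 0, u a * t ^ a ≠ 0 := by
    by_contra! hall
    exact hη (sub_eq_zero.mp (hsub.trans (Finset.sum_eq_zero hall)) ▸ hu 0)
  obtain ⟨i, hi, hi0, -, hord, -⟩ := exists_ord_sum_eq (fun i hi j hj ↦
    eq_of_ord_mul_pow_eq_of_mem_powField h.not_dvd_ord_t hu i
      (Finset.mem_of_mem_erase hi) j (Finset.mem_of_mem_erase hj)) hne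
  refine ⟨u 0, hu 0, fun hdvd ↦ ?_⟩
  rw [hsub, hord, ord_mul (left_ne_zero_of_mul hi0) (right_ne_zero_of_mul hi0), ord_pow, h.ord_t,
    mul_one, Int.dvd_add_right (dvd_ord_of_mem_powField (hu i))] at hdvd
  rw [Finset.mem_erase, Finset.mem_range] at hi
  exact hi.1 (Nat.eq_zero_of_dvd_of_lt (Int.natCast_dvd_natCast.mp hdvd) hi.2)

section Derivation

variable {D : Derivation (powField E p) E E} (hD : D t = 1)
include hD

theorem derivation_mem_ordGE {s : ℤ} {x : E} (hx : x ∈ ordGE v s) : D x ∈ ordGE v (s - 1) := by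
  obtain ⟨u, hu, rfl, hterm⟩ := h.exists_eq_sum_mul_pow_t hx
  rw [map_sum]
  refine sum_mem fun a ha ↦ ?_
  have hDterm : D (u a * t ^ a) = (a : E) * ((u a * t ^ a) * t⁻¹) := by
    rw [derivation_powField_mul D (hu a), D.leibniz_pow, hD]
    rcases a with _ | a
    · simp
    · have := h.t_ne_zero
      simp only [Nat.add_sub_cancel, nsmul_eq_mul, smul_eq_mul, mul_one]
      field_simp
      ring
  rw [hDterm]
  refine integer_mul_mem_ordGE (natCast_mem _ a) ?_
  rw [sub_eq_add_neg]
  refine mul_mem_ordGE (hterm a (Finset.mem_range.mp ha)) (mem_ordGE_of_le ?_)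
  rw [ord_inv, h.ord_t]

omit hD in
theorem exists_leadingCoeff {x : E} (hx : x ≠ 0) :
    ∃ c ∈ k, c ≠ 0 ∧ x - c * t ^ ord v x ∈ ordGE v (ord v x + 1) := by
  have ht := h.t_ne_zero
  have hord : ord v (x * t ^ (-ord v x)) = 0 := by
    rw [ord_mul hx (zpow_ne_zero _ ht), ord_zpow, h.ord_t]
    omega
  obtain ⟨c, hc, hxc⟩ := h.exists_residue _ (mem_ordGE_zero.mp (mem_ordGE_of_le hord.ge))
  refine ⟨c, hc, ?_, ?_⟩
  · rintro rfl
    rw [sub_zero] at hxc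
    have := le_ord_of_mem hxc (mul_ne_zero hx (zpow_ne_zero _ ht))
    omega
  · have hfactor : x - c * t ^ ord v x = (x * t ^ (-ord v x) - c) * t ^ ord v x := by
      rw [sub_mul, mul_assoc, ← zpow_add₀ ht, neg_add_cancel, zpow_zero, mul_one]
    rw [hfactor, add_comm]
    refine mul_mem_ordGE hxc (mem_ordGE_of_le ?_)
    rw [ord_zpow, h.ord_t, mul_one]

theorem ord_derivation {x : E} (hx : x ≠ 0) (hpx : ¬ (p : ℤ) ∣ ord v x) :
    D x ≠ 0 ∧ ord v (D x) = ord v x - 1 := by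
  have ht := h.t_ne_zero
  obtain ⟨c, hc, hc0, hxc⟩ := h.exists_leadingCoeff hx
  set y := x - c * t ^ ord v x with hy
  have hm : ((ord v x : ℤ) : E) ≠ 0 := by rwa [Ne, CharP.intCast_eq_zero_iff E p]
  have hDc : D (c * t ^ ord v x) = ((ord v x : ℤ) : E) * (c * t ^ (ord v x - 1)) := by
    rw [derivation_powField_mul D (h.mem_powField_of_mem hc), D.leibniz_zpow, hD]
    simp only [smul_eq_mul, zsmul_eq_mul]
    ring
  have hne : D (c * t ^ ord v x) ≠ 0 := by
    rw [hDc]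
    exact mul_ne_zero hm (mul_ne_zero hc0 (zpow_ne_zero _ ht))
  have hord : ord v (D (c * t ^ ord v x)) = ord v x - 1 := by
    rw [hDc, ord_mul hm (mul_ne_zero hc0 (zpow_ne_zero _ ht)),
      h.ord_eq_zero (intCast_mem k _), ord_mul hc0 (zpow_ne_zero _ ht), h.ord_eq_zero hc,
      ord_zpow, h.ord_t]
    ring
  have hDy : D y ∈ ordGE v (ord v (D (c * t ^ ord v x)) + 1) := by
    convert h.derivation_mem_ordGE hD hxc using 2
    rw [hord]
    ring
  have hDx : D x = D (c * t ^ ord v x) + D y := by rw [← map_add, hy, add_sub_cancel]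
  rw [hDx, ← hord]
  exact ord_add_of_mem hne hDy

end Derivation

end IsCurveVal

end CurveValuation

section Descent

variable {E : Type u} [Field E]

/-- `E` is obtained from its subfield `L` by extending the field of constants to `k`: some
`L`-basis of `E` through `1` consists of elements of `k` and is a basis of `k` over `k ∩ L`. -/
def Descends (k L : Subfield E) : Prop :=
  ∃ (ι : Type u) (b : Module.Basis ι L E) (i₀ : ι), b i₀ = 1 ∧ (∀ i, b i ∈ k) ∧
    ∀ c ∈ k, ∀ i, (b.repr c i : E) ∈ k

variable {p : ℕ} [Fact p.Prime] [CharP E p] {L : Subfield E}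

variable (p) in
/-- The subfield `L ^ (1 / p)` of the elements whose `p`-th power lies in `L`. -/
abbrev rootField (L : Subfield E) : Subfield E := L.comap (frobenius E p)

theorem mem_rootField {x : E} : x ∈ rootField p L ↔ x ^ p ∈ L := Iff.rfl

theorem le_rootField (L : Subfield E) : L ≤ rootField p L := fun _ hx ↦ pow_mem hx p

section Basis

variable {ι : Type*}

theorem linearIndependent_rootField {b b' : ι → E} (hb : LinearIndependent L b)
    (hbb' : ∀ i, b' i ^ p = b i) : LinearIndependent (rootField p L) b' := by
  rw [linearIndependent_iff'] at hb ⊢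
  intro s g hg i hi
  have hpow : ∑ j ∈ s, (⟨(g j : E) ^ p, (g j).2⟩ : L) • b j = 0 := by
    have := congrArg (· ^ p) hg
    simp only [zero_pow (Fact.out : p.Prime).ne_zero, sum_pow_char] at this
    rw [← this]
    refine Finset.sum_congr rfl fun j _ ↦ ?_
    simp [Subfield.smul_def, mul_pow, hbb']
  have hgi : (g i : E) ^ p = 0 := congrArg Subtype.val (hb s _ hpow i hi)
  exact Subtype.ext (eq_zero_of_pow_eq_zero hgi)

theorem mem_span_rootField (b : Module.Basis ι L E) {b' : ι → E} (hbb' : ∀ i, b' i ^ p = b i)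
    {y : E} (hy : ∀ i, (b.repr (y ^ p) i : E) ∈ powField E p) :
    y ∈ Submodule.span (rootField p L) (Set.range b') := by
  choose r hr using fun i ↦ (mem_powField p).mp (hy i)
  have hsum : y = ∑ j ∈ (b.repr (y ^ p)).support,
      (⟨r j, by rw [mem_rootField, hr]; exact Subtype.prop _⟩ : rootField p L) • b' j := by
    apply frobenius_inj E p
    simp only [frobenius_def, sum_pow_char]
    conv_lhs =>
      rw [← b.linearCombination_repr (y ^ p), Finsupp.linearCombination_apply, Finsupp.sum]
    refine Finset.sum_congr rfl fun j _ ↦ ?_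
    simp [Subfield.smul_def, mul_pow, hbb', hr]
  rw [hsum]
  exact sum_mem fun j _ ↦ Submodule.smul_mem _ _ (Submodule.subset_span ⟨j, rfl⟩)

theorem repr_pow_eq (b : Module.Basis ι L E) (b' : Module.Basis ι (rootField p L) E)
    (hbb' : ∀ i, b' i ^ p = b i) (x : E) (i : ι) :
    (b.repr (x ^ p) i : E) = (b'.repr x i : E) ^ p := by
  have hx : x ^ p = Finsupp.linearCombination L b
      ((b'.repr x).mapRange (fun g : rootField p L ↦ (⟨(g : E) ^ p, g.2⟩ : L))
        (Subtype.ext (by simp [(Fact.out : p.Prime).ne_zero]))) := by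
    conv_lhs => rw [← b'.linearCombination_repr x, Finsupp.linearCombination_apply, Finsupp.sum]
    rw [sum_pow_char, Finsupp.linearCombination_apply, Finsupp.sum_mapRange_index (by simp),
      Finsupp.sum]
    refine Finset.sum_congr rfl fun j _ ↦ ?_
    simp [Subfield.smul_def, mul_pow, hbb']
  rw [hx, Module.Basis.repr_linearCombination, Finsupp.mapRange_apply]

theorem repr_mem_powField {k : Subfield E} (hk : k ≤ powField E p) {b : Module.Basis ι L E}
    (hb : ∀ i, b i ∈ k) (hrepr : ∀ c ∈ k, ∀ i, (b.repr c i : E) ∈ k) {y : E}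
    (hy : y ∈ powField E p) (j : ι) : (b.repr y j : E) ∈ powField E p := by
  obtain ⟨z, rfl⟩ := (mem_powField p).mp hy
  have hz : z ^ p = ∑ i ∈ (b.repr z).support, (b.repr z i) ^ p • (b i) ^ p := by
    conv_lhs => rw [← b.linearCombination_repr z, Finsupp.linearCombination_apply, Finsupp.sum]
    rw [sum_pow_char]
    refine Finset.sum_congr rfl fun i _ ↦ ?_
    simp [Subfield.smul_def, mul_pow]
  rw [hz, map_sum, Finsupp.finsetSum_apply]
  push_cast
  refine sum_mem fun i _ ↦ ?_
  rw [map_smul, Finsupp.smul_apply, smul_eq_mul]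
  push_cast
  exact mul_mem (pow_mem_powField p _) (hk (hrepr _ (pow_mem (hb i) p) j))

end Basis

variable {k : Subfield E}

theorem Descends.rootField (hL : Descends k L) (hroot : ∀ c ∈ k, ∃ d ∈ k, d ^ p = c) :
    Descends k (rootField p L) := by
  obtain ⟨ι, b, i₀, hb1, hbk, hrepr⟩ := hL
  have hk : k ≤ powField E p := fun c hc ↦
    (mem_powField p).mpr ((hroot c hc).imp fun _ ↦ And.right)
  choose b' hb'k hbb' using fun i ↦ hroot (b i) (hbk i)
  let B := Module.Basis.mk (linearIndependent_rootField b.linearIndependent hbb') fun y _ ↦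
    mem_span_rootField b hbb' fun i ↦ repr_mem_powField hk hbk hrepr (pow_mem_powField p y) i
  refine ⟨ι, B, i₀, frobenius_inj E p ?_, fun i ↦ ?_, fun c hc i ↦ ?_⟩
  · simp only [frobenius_def, B, Module.Basis.mk_apply, hbb', hb1, one_pow]
  · simpa only [B, Module.Basis.mk_apply] using hb'k i
  · have hmem := hrepr _ (pow_mem hc p) i
    rw [repr_pow_eq b B (fun i ↦ by rw [Module.Basis.mk_apply, hbb'])] at hmem
    obtain ⟨d, hd, hdc⟩ := hroot _ hmem
    exact frobenius_inj E p hdc ▸ hd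

theorem Descends.exists_eq_sum_mul_pow_of_mem (hL : Descends k L) (hk : k ≤ powField E p)
    (hfr : Module.finrank (powField E p) E = p) {η : E} (hηL : η ∈ L) (hη : η ∉ powField E p)
    {x : E} (hx : x ∈ L) :
    ∃ u : ℕ → E, (∀ a, u a ∈ L ⊓ powField E p) ∧ x = ∑ a ∈ Finset.range p, u a * η ^ a := by
  obtain ⟨ι, b, i₀, hb1, hbk, hrepr⟩ := hL
  obtain ⟨u, hu, hsum⟩ := exists_eq_sum_mul_pow hfr hη x
  have hcoord {y : E} (hy : y ∈ L) (z : E) : (b.repr (z * y) i₀ : E) = b.repr z i₀ * y := by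
    have hsmul : z * y = (⟨y, hy⟩ : L) • z := mul_comm z y
    rw [hsmul, map_smul, Finsupp.smul_apply, smul_eq_mul, mul_comm]
    push_cast
    rfl
  refine ⟨fun a ↦ b.repr (u a) i₀,
    fun a ↦ ⟨Subtype.prop _, repr_mem_powField hk hbk hrepr (hu a) i₀⟩, ?_⟩
  have hone : (b.repr 1 i₀ : E) = 1 := by
    rw [← hb1, b.repr_self, Finsupp.single_eq_same, hb1, OneMemClass.coe_one]
  calc x = b.repr (1 * x) i₀ := by rw [hcoord hx, hone, one_mul]
    _ = b.repr (∑ a ∈ Finset.range p, u a * η ^ a) i₀ := by rw [one_mul, ← hsum]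
    _ = ∑ a ∈ Finset.range p, b.repr (u a) i₀ * η ^ a := by
      rw [map_sum, Finsupp.finsetSum_apply]
      push_cast
      exact Finset.sum_congr rfl fun a _ ↦ hcoord (pow_mem hηL a) _

end Descent

section ResidualIndependence

open scoped WithZero

variable {E : Type*} [Field E] {v : Valuation E ℤᵐ⁰}

theorem residue_eq_residue_iff {x y : v.valuationSubring} :
    IsLocalRing.residue v.valuationSubring x = IsLocalRing.residue v.valuationSubring y ↔
      (x - y : E) ∈ ordGE v 1 := by
  rw [← sub_eq_zero, ← map_sub, IsLocalRing.residue_eq_zero_iff, Valuation.mem_maximalIdeal_iff,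
    mem_ordGE]
  rcases eq_or_ne (x - y : E) 0 with h0 | h0
  · simp [h0]
  · have := WithZero.log_lt_log (v.ne_zero_iff.mpr h0) one_ne_zero
    rw [WithZero.log_one] at this
    push_cast
    rw [← this, forall_prop_of_true h0, ord]
    omega

variable (v) in
/-- The residue field of the restriction of `v` to a subfield `F`, inside that of `v`. -/
def residueSubfield (F : Subfield E) : Subfield (IsLocalRing.ResidueField v.valuationSubring) where
  __ := (F.toSubring.comap v.valuationSubring.subtype).map (IsLocalRing.residue _)
  inv_mem' := by
    rintro _ ⟨z, hz, rfl⟩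
    by_cases h0 : IsLocalRing.residue v.valuationSubring z = 0
    · exact ⟨0, F.zero_mem, by simp [h0]⟩
    · obtain ⟨w, rfl⟩ := (IsLocalRing.residue_ne_zero_iff_isUnit z).mp h0
      have hinv : ((w⁻¹ : v.valuationSubringˣ) : E) = ((w : v.valuationSubring) : E)⁻¹ :=
        eq_inv_of_mul_eq_one_left (congrArg Subtype.val (Units.inv_mul w))
      refine ⟨_, show ((w⁻¹ : v.valuationSubringˣ) : E) ∈ F from hinv ▸ inv_mem hz, ?_⟩
      exact (map_units_inv (IsLocalRing.residue v.valuationSubring) w)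

theorem residue_mem_residueSubfield {F : Subfield E} {x : v.valuationSubring} (hx : (x : E) ∈ F) :
    IsLocalRing.residue v.valuationSubring x ∈ residueSubfield v F := ⟨x, hx, rfl⟩

theorem mem_ordGE_one_of_pow_mem {x : E} {n : ℕ} (hn : n ≠ 0) (hx : x ^ n ∈ ordGE v 1) :
    x ∈ ordGE v 1 := by
  refine mem_ordGE.mpr fun h0 ↦ ?_
  have hle := le_ord_of_mem hx (pow_ne_zero n h0)
  rw [ord_pow] at hle
  exact pos_of_mul_pos_right (hle.trans_lt' zero_lt_one) (by positivity)

variable {p : ℕ} [Fact p.Prime] [CharP E p] {F : Subfield E}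

theorem linearIndependent_residue_pow {y : v.valuationSubring} (hyp : (y : E) ^ p ∈ F)
    (hres : ∀ z ∈ F, z ∈ v.integer → (y : E) - z ∉ ordGE v 1) :
    LinearIndependent (residueSubfield v F) fun i : Fin p ↦
      IsLocalRing.residue v.valuationSubring y ^ (i : ℕ) := by
  have hp := (Fact.out : p.Prime)
  set c := IsLocalRing.residue v.valuationSubring y with hc
  have hcp : c ^ p ∈ residueSubfield v F := by
    rw [hc, ← map_pow]
    exact residue_mem_residueSubfield hyp
  have hirr : Irreducible
      (Polynomial.X ^ p - Polynomial.C (⟨c ^ p, hcp⟩ : residueSubfield v F)) := by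
    refine X_pow_sub_C_irreducible_of_prime hp ?_
    rintro ⟨_, z, hz, rfl⟩ hb
    have hpow : IsLocalRing.residue v.valuationSubring (y ^ p) =
        IsLocalRing.residue v.valuationSubring (z ^ p) := by
      rw [map_pow, map_pow]
      exact (congrArg Subtype.val hb).symm
    rw [residue_eq_residue_iff] at hpow
    push_cast at hpow
    rw [← sub_pow_char] at hpow
    exact hres z hz z.2 (mem_ordGE_one_of_pow_mem hp.ne_zero hpow)
  have hdeg : (minpoly (residueSubfield v F) c).natDegree = p := by
    rw [← minpoly.eq_of_irreducible_of_monic hirr (x := c)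
      (by simp [Algebra.algebraMap_eq_smul_one, Subfield.smul_def])
      (Polynomial.monic_X_pow_sub_C _ hp.ne_zero), Polynomial.natDegree_X_pow_sub_C]
  have hli := linearIndependent_pow (K := residueSubfield v F) c
  rwa [hdeg] at hli

theorem coeff_mem_integer_of_residue_notMem {y : E} (hy : y ∈ v.integer) (hyp : y ^ p ∈ F)
    (hres : ∀ z ∈ F, z ∈ v.integer → y - z ∉ ordGE v 1) {u : ℕ → E} (hu : ∀ a, u a ∈ F)
    (hsum : ∑ a ∈ Finset.range p, u a * y ^ a ∈ v.integer) {a : ℕ} (ha : a < p) :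
    u a ∈ v.integer := by
  classical
  by_contra hcon
  obtain ⟨hua, hord⟩ : u a ≠ 0 ∧ ord v (u a) < 0 := by
    rwa [← mem_ordGE_zero, mem_ordGE, Classical.not_imp, not_le] at hcon
  obtain ⟨b, hb, hmin⟩ := Finset.exists_min_image ((Finset.range p).filter fun i ↦ u i ≠ 0)
    (fun i ↦ ord v (u i)) ⟨a, by simp [ha, hua]⟩
  simp only [Finset.mem_filter, Finset.mem_range] at hb hmin
  have hw (i : Fin p) : u i * (u b)⁻¹ ∈ v.integer := by
    refine mem_ordGE_zero.mp (mem_ordGE.mpr fun h0 ↦ ?_)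
    rw [ord_mul (left_ne_zero_of_mul h0) (inv_ne_zero hb.2), ord_inv]
    linarith [hmin i ⟨i.2, left_ne_zero_of_mul h0⟩]
  let w (i : Fin p) : residueSubfield v F :=
    ⟨_, residue_mem_residueSubfield (x := ⟨_, hw i⟩) (mul_mem (hu i) (inv_mem (hu b)))⟩
  have hscaled : (∑ i ∈ Finset.range p, u i * y ^ i) * (u b)⁻¹ ∈ ordGE v 1 := by
    refine integer_mul_mem_ordGE hsum (mem_ordGE_of_le ?_)
    rw [ord_inv]
    linarith [hmin a ⟨ha, hua⟩]
  have hzero : ∑ i, w i • IsLocalRing.residue v.valuationSubring ⟨y, hy⟩ ^ (i : ℕ) = 0 := by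
    have hresidue := (residue_eq_residue_iff (v := v)
      (x := ∑ i : Fin p, ⟨_, hw i⟩ * ⟨y, hy⟩ ^ (i : ℕ)) (y := 0)).mpr (by
        rw [Finset.sum_range, Finset.sum_mul] at hscaled
        push_cast
        simpa only [sub_zero, mul_right_comm] using hscaled)
    rw [map_zero, map_sum] at hresidue
    simpa only [map_mul, map_pow, w, Subfield.smul_def, smul_eq_mul] using hresidue
  have hwb := Fintype.linearIndependent_iff.mp
    (linearIndependent_residue_pow (y := ⟨y, hy⟩) hyp hres) w hzero ⟨b, hb.1⟩
  have hone := congrArg Subtype.val hwb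
  simp only [w, mul_inv_cancel₀ hb.2] at hone
  exact one_ne_zero ((map_one (IsLocalRing.residue v.valuationSubring)).symm.trans hone)

end ResidualIndependence

section Approximation

open scoped WithZero

variable {E : Type*} [Field E] {v : Valuation E ℤᵐ⁰} {L : Subfield E} {π : E}

theorem exists_uniformizer_of_subfield (hL : ∃ x ∈ L, 0 < ord v x) :
    ∃ π ∈ L, 0 < ord v π ∧ ∀ x ∈ L, ord v π ∣ ord v x := by
  classical
  have hex : ∃ n : ℕ, 0 < n ∧ ∃ x ∈ L, ord v x = n := by
    obtain ⟨x, hx, hpos⟩ := hL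
    exact ⟨(ord v x).toNat, by omega, x, hx, by omega⟩
  obtain ⟨hpos, π, hπ, hn⟩ : 0 < Nat.find hex ∧ ∃ x ∈ L, ord v x = Nat.find hex :=
    Nat.find_spec hex
  have hπ0 : π ≠ 0 := by
    rintro rfl
    have : ord v 0 = 0 := by simp [ord]
    omega
  refine ⟨π, hπ, by omega, fun x hx ↦ ?_⟩
  rcases eq_or_ne x 0 with rfl | hx0
  · simp [ord]
  have hord : ord v (x * π ^ (-(ord v x / ord v π))) = ord v x % ord v π := by
    rw [ord_mul hx0 (zpow_ne_zero _ hπ0), ord_zpow]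
    linarith [Int.emod_add_mul_ediv (ord v x) (ord v π)]
  have hlt := Int.emod_lt_of_pos (ord v x) (show 0 < ord v π by omega)
  have hge := Int.emod_nonneg (ord v x) (show ord v π ≠ 0 by omega)
  refine Int.dvd_of_emod_eq_zero (hge.eq_of_not_lt fun hmod ↦ ?_).symm
  exact Nat.find_min hex (m := (ord v x % ord v π).toNat) (by omega)
    ⟨by omega, _, mul_mem hx (zpow_mem hπ _), by rw [hord]; omega⟩

theorem exists_mem_sub_mem_ordGE {F : Subfield E} (hFL : F ≤ L) (hπ : π ∈ F) (hpos : 0 < ord v π)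
    (hdvd : ∀ x ∈ L, ord v π ∣ ord v x)
    (hres : ∀ y ∈ L, y ∈ v.integer → ∃ z ∈ F, z ∈ v.integer ∧ y - z ∈ ordGE v 1) (M : ℕ) :
    ∀ y ∈ L, y ∈ v.integer → ∃ z ∈ F, y - z ∈ ordGE v M := by
  have hπ0 : π ≠ 0 := by
    rintro rfl
    simp [ord] at hpos
  induction M with
  | zero => exact fun y _ hy ↦ ⟨0, zero_mem _, by simpa using mem_ordGE_zero.mpr hy⟩
  | succ M ih =>
    intro y hy hy0
    obtain ⟨z, hz, -, hyz⟩ := hres y hy hy0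
    have hyzL := sub_mem hy (hFL hz)
    have hquot : (y - z) * π⁻¹ ∈ v.integer := by
      refine mem_ordGE_zero.mp (mem_ordGE.mpr fun h0 ↦ ?_)
      have hyz0 := left_ne_zero_of_mul h0
      rw [ord_mul hyz0 (inv_ne_zero hπ0), ord_inv]
      have hpos' := le_ord_of_mem hyz hyz0
      linarith [Int.le_of_dvd (by omega) (hdvd _ hyzL)]
    obtain ⟨z', hz', hyz'⟩ := ih _ (mul_mem hyzL (inv_mem (hFL hπ))) hquot
    refine ⟨z + π * z', add_mem hz (mul_mem hπ hz'), ?_⟩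
    have hfactor : y - (z + π * z') = π * ((y - z) * π⁻¹ - z') := by
      field_simp
      ring
    rw [hfactor]
    refine ordGE_anti ?_ (mul_mem_ordGE (mem_ordGE_of_le le_rfl) hyz')
    push_cast
    omega

end Approximation

section Generator

open scoped WithZero

variable {E : Type*} [Field E]

/-- The `k`-span of the valuation ring `L ∩ 𝒪` of a subfield `L`. When `E` is obtained from `L` by
extension of constants to `k`, this is the ring obtained from `L ∩ 𝒪` by the same extension. -/
def valSpan (v : Valuation E ℤᵐ⁰) (k L : Subfield E) : Submodule k E :=
  Submodule.span k {x | x ∈ L ∧ x ∈ v.integer}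

variable {p : ℕ} [Fact p.Prime] {v : Valuation E ℤᵐ⁰} {k L : Subfield E} {t π : E}

theorem coeff_mem_integer_of_dvd_ord (hpos : 0 < ord v π) {u : ℕ → E}
    (hu : ∀ a < p, u a ≠ 0 → (p : ℤ) * ord v π ∣ ord v (u a))
    (hsum : ∑ a ∈ Finset.range p, u a * π ^ a ∈ v.integer) {a : ℕ} (ha : a < p) :
    u a ∈ v.integer := by
  have hp1 : ¬ (p : ℤ) ∣ 1 := by
    exact_mod_cast (Fact.out : p.Prime).one_lt.ne' ∘ Nat.dvd_one.mp
  have hπ0 : π ≠ 0 := by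
    rintro rfl
    simp [ord] at hpos
  refine mem_ordGE_zero.mp (mem_ordGE.mpr fun h0 ↦ ?_)
  have hterm := le_ord_of_mem (mem_ordGE_of_sum_mem
    (eq_of_ord_mul_pow_eq hpos.ne' hp1 (mul_one _).symm hu) (mem_ordGE_zero.mpr hsum)
    (Finset.mem_range.mpr ha)) (mul_ne_zero h0 (pow_ne_zero a hπ0))
  rw [ord_mul h0 (pow_ne_zero a hπ0), ord_pow] at hterm
  obtain ⟨m, hm⟩ := hu a ha h0
  rw [hm] at hterm ⊢
  by_contra! hneg
  have hm0 : m ≤ -1 := by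
    by_contra! hm0
    exact hneg.not_ge (mul_nonneg (by positivity) (by omega))
  have : (a : ℤ) < p := by exact_mod_cast ha
  nlinarith [mul_pos (show (0 : ℤ) < p by omega) hpos]

theorem exists_ord_eq_of_not_dvd {F : Subfield E} (hπF : π ^ p ∈ F) (hπ0 : π ≠ 0) {x : E}
    (hx : x ∈ F) (hdvd : ord v π ∣ ord v x) (hpdvd : ¬ (p : ℤ) * ord v π ∣ ord v x) :
    ∃ π' ∈ F, ord v π' = ord v π := by
  obtain ⟨j, hj⟩ := hdvd
  have hx0 : x ≠ 0 := by
    rintro rfl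
    simp [ord] at hpdvd
  have hpj : ¬ (p : ℤ) ∣ j := fun ⟨m, hm⟩ ↦ hpdvd ⟨m, by rw [hj, hm]; ring⟩
  obtain ⟨α, β, hαβ⟩ := (Nat.prime_iff_prime_int.mp
    (Fact.out : p.Prime)).irreducible.coprime_iff_not_dvd.mpr hpj
  refine ⟨x ^ β * (π ^ p) ^ α, mul_mem (zpow_mem hx _) (zpow_mem hπF _), ?_⟩
  rw [ord_mul (zpow_ne_zero _ hx0) (zpow_ne_zero _ (pow_ne_zero p hπ0)), ord_zpow, ord_zpow,
    ord_pow, hj]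
  linear_combination (ord v π) * hαβ

/-- An element `η` of the valuation ring `L ∩ 𝒪` whose powers `η ^ a` with `a < p` form a basis
over the subring `L ∩ E ^ p ∩ 𝒪`. Their independence is encoded by `η ∉ E ^ p`. -/
structure IsGenerator (p : ℕ) [Fact p.Prime] [CharP E p] (v : Valuation E ℤᵐ⁰) (L : Subfield E)
    (η : E) : Prop where
  mem : η ∈ L
  mem_integer : η ∈ v.integer
  notMem_powField : η ∉ powField E p
  exists_coeff : ∀ x ∈ L, x ∈ v.integer → ∃ u : ℕ → E,
    (∀ a < p, u a ∈ L ⊓ powField E p ∧ u a ∈ v.integer) ∧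
      x = ∑ a ∈ Finset.range p, u a * η ^ a

variable [CharP E p]

namespace IsCurveVal

variable (h : IsCurveVal p v k t)
include h

theorem exists_powField_sub_mem_ordGE {M : ℤ}
    (happrox : ∀ y ∈ L, y ∈ v.integer → ∃ z ∈ powField E p, y - z ∈ ordGE v M) {x : E}
    (hx : x ∈ valSpan v k L) : ∃ z ∈ powField E p, x - z ∈ ordGE v M := by
  induction hx using Submodule.span_induction with
  | mem x hx => exact happrox x hx.1 hx.2
  | zero => exact ⟨0, zero_mem _, by simp⟩
  | add x y _ _ hx hy =>
    obtain ⟨a, ha, hxa⟩ := hx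
    obtain ⟨b, hb, hyb⟩ := hy
    exact ⟨a + b, add_mem ha hb, add_sub_add_comm x y a b ▸ add_mem hxa hyb⟩
  | smul c x _ hx =>
    obtain ⟨a, ha, hxa⟩ := hx
    refine ⟨c * a, mul_mem (h.mem_powField_of_mem c.2) ha, ?_⟩
    rw [Subfield.smul_def, smul_eq_mul, ← mul_sub]
    exact integer_mul_mem_ordGE (h.mem_integer c c.2) hxa

theorem exists_residue_notMem (hπ : π ∈ L ⊓ powField E p) (hpos : 0 < ord v π)
    (hdvd : ∀ x ∈ L, ord v π ∣ ord v x) {N : ℤ} (hN : ∀ x ∈ ordGE v N, x ∈ valSpan v k L) :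
    ∃ y ∈ L, y ∈ v.integer ∧ ∀ z ∈ L ⊓ powField E p, z ∈ v.integer → y - z ∉ ordGE v 1 := by
  by_contra! hcon
  have hp := (Fact.out : p.Prime)
  set j := p * N.natAbs + 1
  have hord : ord v (t ^ j) = j := by rw [ord_pow, h.ord_t, mul_one]
  have hjN : N ≤ j := by
    have : N.natAbs ≤ p * N.natAbs := Nat.le_mul_of_pos_left _ hp.pos
    omega
  obtain ⟨a, ha, hta⟩ := h.exists_powField_sub_mem_ordGE (M := (j + 1 : ℕ)) (fun y hy hy0 ↦
    (exists_mem_sub_mem_ordGE inf_le_left hπ hpos hdvd hcon (j + 1) y hy hy0).imp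
      fun _ hz ↦ ⟨hz.1.2, hz.2⟩) (hN (t ^ j) (mem_ordGE_of_le (hord ▸ hjN)))
  have hadd := (ord_add_of_mem (pow_ne_zero j h.t_ne_zero) (y := -(t ^ j - a))
    (neg_mem (by rw [hord]; exact_mod_cast hta))).2
  rw [← sub_eq_add_neg, sub_sub_cancel, hord] at hadd
  have hpj := (Nat.dvd_add_right (dvd_mul_right p N.natAbs)).mp
    (Int.natCast_dvd_natCast.mp (hadd ▸ dvd_ord_of_mem_powField ha))
  exact hp.one_lt.ne' (Nat.dvd_one.mp hpj)

theorem isGenerator_of_coeff_mem (hL : Descends k L) {η : E} (hηL : η ∈ L) (hη : η ∈ v.integer)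
    (hηF : η ∉ powField E p)
    (hcoeff : ∀ u : ℕ → E, (∀ a, u a ∈ L ⊓ powField E p) →
      ∑ a ∈ Finset.range p, u a * η ^ a ∈ v.integer → ∀ a < p, u a ∈ v.integer) :
    IsGenerator p v L η where
  mem := hηL
  mem_integer := hη
  notMem_powField := hηF
  exists_coeff x hx hx0 := by
    obtain ⟨u, hu, rfl⟩ := hL.exists_eq_sum_mul_pow_of_mem (fun _ ↦ h.mem_powField_of_mem)
      h.finrank_powField hηL hηF hx
    exact ⟨u, fun a ha ↦ ⟨hu a, hcoeff u hu hx0 a ha⟩, rfl⟩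

/-- If `L` is ramified over `L ∩ E ^ p`, a uniformizer of `L` is a generator. Otherwise some
element of `L ∩ 𝒪` has its residue outside the residue field of `L ∩ E ^ p`. -/
theorem exists_isGenerator (hL : Descends k L) (hpos : ∃ x ∈ L, 0 < ord v x) {N : ℤ}
    (hN : ∀ x ∈ ordGE v N, x ∈ valSpan v k L) : ∃ η, IsGenerator p v L η := by
  have hp := (Fact.out : p.Prime)
  obtain ⟨π, hπ, hπpos, hdvd⟩ := exists_uniformizer_of_subfield hpos
  by_cases hram : ∀ x ∈ L ⊓ powField E p, (p : ℤ) * ord v π ∣ ord v x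
  · have hπF : π ∉ powField E p := fun hF ↦ by
      have hle := Int.le_of_dvd hπpos (hram π ⟨hπ, hF⟩)
      have htwo : (2 : ℤ) ≤ p := by exact_mod_cast hp.two_le
      nlinarith
    exact ⟨π, h.isGenerator_of_coeff_mem hL hπ (mem_ordGE_zero.mp (mem_ordGE_of_le hπpos.le)) hπF
      fun u hu hsum a ha ↦
        coeff_mem_integer_of_dvd_ord hπpos (fun a _ _ ↦ hram _ (hu a)) hsum ha⟩
  · push Not at hram
    obtain ⟨x, hx, hxd⟩ := hram
    have hπ0 : π ≠ 0 := by
      rintro rfl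
      simp [ord] at hπpos
    obtain ⟨π', hπ', hord⟩ := exists_ord_eq_of_not_dvd
      (F := L ⊓ powField E p) ⟨pow_mem hπ p, pow_mem_powField p π⟩ hπ0 hx (hdvd x hx.1) hxd
    obtain ⟨y, hyL, hy, hres⟩ :=
      h.exists_residue_notMem hπ' (hord ▸ hπpos) (hord ▸ hdvd) hN
    have hyF : y ∉ powField E p := fun hF ↦ hres y ⟨hyL, hF⟩ hy (by simp)
    exact ⟨y, h.isGenerator_of_coeff_mem hL hyL hy hyF fun u hu hsum a ha ↦
      coeff_mem_integer_of_residue_notMem (F := L ⊓ powField E p) hy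
        ⟨pow_mem hyL p, pow_mem_powField p y⟩ hres hu hsum ha⟩

end IsCurveVal

end Generator

section TopCoefficient

theorem toLinearMap_pow_apply_pow {R A : Type*} [CommSemiring R] [CommSemiring A] [Algebra R A]
    (D : Derivation R A A) {x : A} (hx : D x = 1) (n j : ℕ) :
    (D.toLinearMap ^ j) (x ^ n) = (n.descFactorial j : A) * x ^ (n - j) := by
  induction j with
  | zero => simp
  | succ j ih =>
    rw [pow_succ', Module.End.mul_apply, ih, Derivation.coeFn_coe, D.leibniz,
      D.map_natCast, D.leibniz_pow, hx, Nat.descFactorial_succ, Nat.sub_sub]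
    simp only [nsmul_eq_mul, smul_eq_mul, Nat.cast_mul]
    ring

variable {E : Type*} [Field E] {p : ℕ} [Fact p.Prime] [CharP E p]

/-- For `D ζ = 1`, the functional taking `∑ a < p, u a * ζ ^ a` with `u a ∈ E ^ p` to `u (p - 1)`.
Since `(p - 1)! = -1` in `E`, it is `-D ^ (p - 1)`. In particular it does not change when `ζ` is
translated by an element of `E ^ p`. -/
def topCoeff (D : Derivation (powField E p) E E) : E →ₗ[powField E p] E :=
  -D.toLinearMap ^ (p - 1)

variable {D : Derivation (powField E p) E E} {ζ : E}

theorem topCoeff_pow (hζ : D ζ = 1) {n : ℕ} (hn : n < 2 * p - 1) :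
    topCoeff D (ζ ^ n) = if n = p - 1 then 1 else 0 := by
  have hlow {m : ℕ} (hm : m < p - 1) : topCoeff D (ζ ^ m) = 0 := by
    rw [topCoeff, LinearMap.neg_apply, toLinearMap_pow_apply_pow D hζ,
      Nat.descFactorial_of_lt hm, Nat.cast_zero, zero_mul, neg_zero]
  split_ifs with h
  · have hwilson : ((p - 1).factorial : E) = -1 := by
      rw [← map_natCast (ZMod.castHom dvd_rfl E), ZMod.wilsons_lemma, map_neg, map_one]
    rw [topCoeff, LinearMap.neg_apply, toLinearMap_pow_apply_pow D hζ, h,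
      Nat.descFactorial_self, hwilson]
    simp
  · rcases lt_or_ge n p with hlt | hge
    · exact hlow (by omega)
    · obtain ⟨m, rfl⟩ := Nat.exists_eq_add_of_le hge
      rw [pow_add, map_powField_mul _ (pow_mem_powField p ζ), hlow (by omega), mul_zero]

theorem topCoeff_pow_mul_sum (hζ : D ζ = 1) {u : ℕ → E} (hu : ∀ a, u a ∈ powField E p) {i : ℕ}
    (hi : i < p) :
    topCoeff D (ζ ^ i * ∑ a ∈ Finset.range p, u a * ζ ^ a) = u (p - 1 - i) := by
  have hterm : ∀ a ∈ Finset.range p, topCoeff D (ζ ^ i * (u a * ζ ^ a)) =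
      if a = p - 1 - i then u a else 0 := by
    intro a ha
    rw [Finset.mem_range] at ha
    rw [mul_left_comm, map_powField_mul _ (hu a), ← pow_add, topCoeff_pow hζ (by omega), mul_ite,
      mul_one, mul_zero]
    exact if_congr (by omega) rfl rfl
  rw [Finset.mul_sum, map_sum, Finset.sum_congr rfl hterm, Finset.sum_ite_eq',
    if_pos (Finset.mem_range.mpr (by omega))]

theorem topCoeff_sum (hζ : D ζ = 1) {u : ℕ → E} (hu : ∀ a, u a ∈ powField E p) :
    topCoeff D (∑ a ∈ Finset.range p, u a * ζ ^ a) = u (p - 1) := by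
  simpa using topCoeff_pow_mul_sum hζ hu (Fact.out : p.Prime).pos

end TopCoefficient

section SpanOfValuationRing

open scoped WithZero

variable {E : Type*} [Field E] {p : ℕ} [Fact p.Prime] {v : Valuation E ℤᵐ⁰}
  {k L : Subfield E} {t η x : E}

theorem valSpan_mono {L' : Subfield E} (h : L ≤ L') : valSpan v k L ≤ valSpan v k L' :=
  Submodule.span_mono fun _ hx ↦ ⟨h hx.1, hx.2⟩

variable [CharP E p]

theorem pow_mem_valSpan (hx : x ∈ valSpan v k (rootField p L)) :
    x ^ p ∈ valSpan v k (L ⊓ powField E p) := by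
  induction hx using Submodule.span_induction with
  | mem x hx => exact Submodule.subset_span ⟨⟨hx.1, pow_mem_powField p x⟩, pow_mem hx.2 p⟩
  | zero => simp [(Fact.out : p.Prime).ne_zero]
  | add x y _ _ hx hy =>
    rw [add_pow_char]
    exact add_mem hx hy
  | smul c x _ hx =>
    rw [Subfield.smul_def, smul_eq_mul, mul_pow]
    exact Submodule.smul_mem _ (c ^ p) hx

theorem exists_pow_eq_of_mem_valSpan (hk : ∀ c ∈ k, ∃ d ∈ k, d ^ p = c)
    (hx : x ∈ valSpan v k (L ⊓ powField E p)) : ∃ y ∈ valSpan v k (rootField p L), y ^ p = x := by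
  have hp := (Fact.out : p.Prime)
  induction hx using Submodule.span_induction with
  | mem x hx =>
    obtain ⟨y, rfl⟩ := (mem_powField p).mp hx.1.2
    refine ⟨y, Submodule.subset_span ⟨hx.1.1, ?_⟩, rfl⟩
    simpa [Valuation.mem_integer_iff, pow_le_one_iff hp.ne_zero] using hx.2
  | zero => exact ⟨0, zero_mem _, by simp [hp.ne_zero]⟩
  | add x y _ _ hx hy =>
    obtain ⟨a, ha, rfl⟩ := hx
    obtain ⟨b, hb, rfl⟩ := hy
    exact ⟨a + b, add_mem ha hb, by rw [add_pow_char]⟩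
  | smul c x _ hx =>
    obtain ⟨a, ha, rfl⟩ := hx
    obtain ⟨d, hd, hdc⟩ := hk c c.2
    refine ⟨d * a, Submodule.smul_mem _ (⟨d, hd⟩ : k) ha, ?_⟩
    rw [mul_pow, hdc, Subfield.smul_def, smul_eq_mul]

theorem pow_mem_valSpan_iff (hk : ∀ c ∈ k, ∃ d ∈ k, d ^ p = c) :
    x ^ p ∈ valSpan v k (L ⊓ powField E p) ↔ x ∈ valSpan v k (rootField p L) := by
  refine ⟨fun hx ↦ ?_, pow_mem_valSpan⟩
  obtain ⟨y, hy, hyx⟩ := exists_pow_eq_of_mem_valSpan hk hx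
  exact frobenius_inj E p hyx ▸ hy

namespace IsGenerator

variable (hη : IsGenerator p v L η)
include hη

theorem exists_derivation_eq (D : Derivation (powField E p) E E) (hx : x ∈ L)
    (hxv : x ∈ v.integer) : ∃ y ∈ L, y ∈ v.integer ∧ D x = y * D η := by
  obtain ⟨u, hu, rfl⟩ := hη.exists_coeff x hx hxv
  refine ⟨∑ a ∈ Finset.range p, u a * (a * η ^ (a - 1)), sum_mem fun a ha ↦ ?_,
    sum_mem fun a ha ↦ ?_, ?_⟩
  · exact mul_mem (hu a (Finset.mem_range.mp ha)).1.1
      (mul_mem (natCast_mem _ a) (pow_mem hη.mem _))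
  · exact mul_mem (hu a (Finset.mem_range.mp ha)).2
      (mul_mem (natCast_mem _ a) (pow_mem hη.mem_integer _))
  · rw [map_sum, Finset.sum_mul]
    refine Finset.sum_congr rfl fun a ha ↦ ?_
    rw [derivation_powField_mul D (hu a (Finset.mem_range.mp ha)).1.2, D.leibniz_pow]
    simp only [nsmul_eq_mul, smul_eq_mul]
    ring

theorem exists_coeff_mem_valSpan (hx : x ∈ valSpan v k L) :
    ∃ u : ℕ → E, (∀ a, u a ∈ valSpan v k (L ⊓ powField E p)) ∧
      x = ∑ a ∈ Finset.range p, u a * η ^ a := by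
  induction hx using Submodule.span_induction with
  | mem x hx =>
    obtain ⟨u, hu, hsum⟩ := hη.exists_coeff x hx.1 hx.2
    refine ⟨fun a ↦ if a < p then u a else 0, fun a ↦ ?_, hsum.trans (Finset.sum_congr rfl
      fun a ha ↦ by simp only [if_pos (Finset.mem_range.mp ha)])⟩
    dsimp only
    split_ifs with ha
    exacts [Submodule.subset_span (hu a ha), zero_mem _]
  | zero => exact ⟨0, fun _ ↦ zero_mem _, by simp⟩
  | add x y _ _ hx hy =>
    obtain ⟨u, hu, rfl⟩ := hx
    obtain ⟨w, hw, rfl⟩ := hy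
    exact ⟨u + w, fun a ↦ add_mem (hu a) (hw a), by simp [add_mul, Finset.sum_add_distrib]⟩
  | smul c x _ hx =>
    obtain ⟨u, hu, rfl⟩ := hx
    exact ⟨fun a ↦ c • u a, fun a ↦ Submodule.smul_mem _ c (hu a), by simp [Finset.smul_sum]⟩

theorem mul_pow_mem_valSpan (hx : x ∈ valSpan v k (L ⊓ powField E p)) (a : ℕ) :
    x * η ^ a ∈ valSpan v k L := by
  induction hx using Submodule.span_induction with
  | mem x hx =>
    exact Submodule.subset_span
      ⟨mul_mem hx.1.1 (pow_mem hη.mem a), mul_mem hx.2 (pow_mem hη.mem_integer a)⟩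
  | zero => simp
  | add x y _ _ hx hy =>
    rw [add_mul]
    exact add_mem hx hy
  | smul c x _ hx =>
    rw [smul_mul_assoc]
    exact Submodule.smul_mem _ c hx

end IsGenerator

namespace IsCurveVal

variable (h : IsCurveVal p v k t)
include h

theorem mem_integer_of_mem_valSpan (hx : x ∈ valSpan v k L) : x ∈ v.integer := by
  induction hx using Submodule.span_induction with
  | mem x hx => exact hx.2
  | zero => exact zero_mem _
  | add x y _ _ hx hy => exact add_mem hx hy
  | smul c x _ hx => exact mul_mem (h.mem_integer c c.2) hx

theorem mem_valSpan_iff_topCoeff (hη : IsGenerator p v L η)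
    {D : Derivation (powField E p) E E} (hD : D η = 1) :
    x ∈ valSpan v k L ↔ ∀ i < p, topCoeff D (η ^ i * x) ∈ valSpan v k (L ⊓ powField E p) := by
  constructor
  · intro hx i hi
    obtain ⟨u, hu, rfl⟩ := hη.exists_coeff_mem_valSpan hx
    rw [topCoeff_pow_mul_sum hD (fun a ↦ ?_) hi]
    · exact hu _
    · obtain ⟨y, -, hy⟩ := exists_pow_eq_of_mem_valSpan h.exists_root (hu a)
      exact (mem_powField p).mpr ⟨y, hy⟩
  · intro hx
    obtain ⟨u, hu, rfl⟩ := exists_eq_sum_mul_pow h.finrank_powField hη.notMem_powField x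
    refine sum_mem fun a ha ↦ hη.mul_pow_mem_valSpan ?_ a
    rw [Finset.mem_range] at ha
    have hcoeff := hx (p - 1 - a) (by omega)
    rwa [topCoeff_pow_mul_sum hD hu (by omega), show p - 1 - (p - 1 - a) = a by omega] at hcoeff

theorem exists_topCoeff_eq_pow_iff {D : Derivation (powField E p) E E} {ζ y : E} (hD : D ζ = 1)
    (hζ : ¬ (p : ℤ) ∣ ord v ζ) {s : ℤ} :
    (∃ x ∈ ordGE v s, topCoeff D x = y ^ p) ↔ y ^ p * ζ ^ (p - 1) ∈ ordGE v s := by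
  have hp := (Fact.out : p.Prime)
  constructor
  · rintro ⟨x, hx, hxy⟩
    have hζF : ζ ∉ powField E p := fun hF ↦ hζ (dvd_ord_of_mem_powField hF)
    obtain ⟨u, hu, rfl⟩ := exists_eq_sum_mul_pow h.finrank_powField hζF x
    rw [topCoeff_sum hD hu] at hxy
    exact hxy ▸ mem_ordGE_of_sum_mem (eq_of_ord_mul_pow_eq_of_mem_powField hζ hu) hx
      (Finset.mem_range.mpr (Nat.sub_lt hp.pos one_pos))
  · refine fun hy ↦ ⟨_, hy, ?_⟩
    rw [map_powField_mul _ (pow_mem_powField p y),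
      topCoeff_pow hD (by have := hp.pos; omega), if_pos rfl, mul_one]

theorem topCoeff_mem_powField {D : Derivation (powField E p) E E} (hη : η ∉ powField E p)
    (hD : D η = 1) (x : E) : topCoeff D x ∈ powField E p := by
  obtain ⟨u, hu, rfl⟩ := exists_eq_sum_mul_pow h.finrank_powField hη x
  exact topCoeff_sum hD hu ▸ hu _

end IsCurveVal

end SpanOfValuationRing

section ConductorFormula

open scoped WithZero

variable {E : Type*} [Field E]

/-- The conductor exponent of an additive subgroup `M` of the valuation ring: the least `c` such
that `M` contains all elements of order at least `c`. -/
def IsConductorExponent (v : Valuation E ℤᵐ⁰) (M : AddSubgroup E) (c : ℤ) : Prop :=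
  ∀ s, ordGE v s ≤ M ↔ c ≤ s

variable {p : ℕ} [Fact p.Prime] {v : Valuation E ℤᵐ⁰} {k L : Subfield E} {t η : E}

theorem pow_mul_pow_mem_ordGE_iff {y ζ : E} (hζ : ζ ≠ 0) {s : ℤ} {q : ℕ} :
    y ^ p * ζ ^ q ∈ ordGE v s ↔ y ∈ ordGE v (-((q * ord v ζ - s) / p)) := by
  have hp := (Fact.out : p.Prime)
  rcases eq_or_ne y 0 with rfl | hy
  · simp [hp.ne_zero]
  rw [mem_ordGE, mem_ordGE, forall_prop_of_true hy,
    forall_prop_of_true (mul_ne_zero (pow_ne_zero p hy) (pow_ne_zero q hζ)),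
    ord_mul (pow_ne_zero p hy) (pow_ne_zero q hζ), ord_pow, ord_pow, neg_le,
    Int.le_ediv_iff_mul_le (by exact_mod_cast hp.pos)]
  constructor <;> intro <;> linarith

variable [CharP E p]

namespace IsCurveVal

variable (h : IsCurveVal p v k t)
include h

/- Since `topCoeff` detects membership in the span of `L`, the inclusion of `ordGE v s` in it
becomes a condition on elements of the span of `L ∩ E ^ p`, which are the `p`-th powers of the
elements of the span of `rootField p L`. -/
theorem isConductorExponent_of_rootField {D : Derivation (powField E p) E E} (hD : D t = 1)
    (hη : IsGenerator p v L η) {c : ℤ}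
    (hc : IsConductorExponent v (valSpan v k (rootField p L)).toAddSubgroup c) :
    IsConductorExponent v (valSpan v k L).toAddSubgroup ((p - 1) * ord v (D η) + p * c) := by
  intro s
  have hp := (Fact.out : p.Prime)
  obtain ⟨w, hw, hndvd⟩ := h.exists_not_dvd_ord_sub hη.notMem_powField
  obtain ⟨T, hT⟩ := exists_derivation_apply_eq_one h.finrank_powField hη.notMem_powField
  set ζ := η - w
  have hζ0 : ζ ≠ 0 := by
    intro h0
    simp [h0, ord] at hndvd
  have hT' : T ζ = 1 := by rw [map_sub, derivation_powField T hw, sub_zero, hT]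
  have hord : ord v (D η) = ord v ζ - 1 := by
    rw [← (h.ord_derivation hD hζ0 hndvd).2, map_sub, derivation_powField D hw, sub_zero]
  have hcast : ((p - 1 : ℕ) : ℤ) = p - 1 := Nat.cast_pred hp.pos
  calc ordGE v s ≤ (valSpan v k L).toAddSubgroup
    _ ↔ ∀ x ∈ ordGE v s, topCoeff T x ∈ valSpan v k (L ⊓ powField E p) := by
      refine ⟨fun hs x hx ↦ ?_, fun hs x hx ↦ ?_⟩
      · simpa using (h.mem_valSpan_iff_topCoeff hη hT).mp (hs hx) 0 hp.pos
      · exact (h.mem_valSpan_iff_topCoeff hη hT).mpr fun i _ ↦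
          hs _ (integer_mul_mem_ordGE (pow_mem hη.mem_integer i) hx)
    _ ↔ ∀ y, y ^ p * ζ ^ (p - 1) ∈ ordGE v s → y ∈ valSpan v k (rootField p L) := by
      simp only [← h.exists_topCoeff_eq_pow_iff hT' hndvd, ← pow_mem_valSpan_iff h.exists_root]
      refine ⟨fun hs y ⟨x, hx, hxy⟩ ↦ hxy ▸ hs x hx, fun hs x hx ↦ ?_⟩
      obtain ⟨y, hy⟩ :=
        (mem_powField p).mp (h.topCoeff_mem_powField hη.notMem_powField hT x)
      exact hy ▸ hs y ⟨x, hx, hy.symm⟩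
    _ ↔ c ≤ -(((p - 1 : ℕ) * ord v ζ - s) / p) := by
      simp only [pow_mul_pow_mem_ordGE_iff hζ0]
      exact hc _
    _ ↔ (p - 1) * ord v (D η) + p * c ≤ s := by
      rw [le_neg, ← Int.lt_add_one_iff, Int.ediv_lt_iff_lt_mul (by exact_mod_cast hp.pos), hcast,
        hord]
      constructor <;> intro <;> linarith

section Derivation

variable {D : Derivation (powField E p) E E} (hD : D t = 1)
include hD

theorem derivation_mem_integer {x : E} (hx : x ∈ v.integer) : D x ∈ v.integer := by
  obtain ⟨c, hc, hxc⟩ := h.exists_residue x hx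
  have hDx := h.derivation_mem_ordGE hD hxc
  rw [map_sub, derivation_powField D (h.mem_powField_of_mem hc), sub_zero] at hDx
  exact mem_ordGE_zero.mp hDx

theorem derivation_ne_zero (hη : η ∉ powField E p) : D η ≠ 0 := by
  obtain ⟨w, hw, hndvd⟩ := h.exists_not_dvd_ord_sub hη
  have hne : η - w ≠ 0 := by
    intro h0
    simp [h0, ord] at hndvd
  simpa [derivation_powField D hw] using (h.ord_derivation hD hne hndvd).1

end Derivation

theorem integer_le_valSpan_of_t_mem (ht : t ∈ L) {N : ℕ}
    (hN : ordGE v N ≤ (valSpan v k L).toAddSubgroup) :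
    ordGE v 0 ≤ (valSpan v k L).toAddSubgroup := by
  have htv : t ∈ v.integer := mem_ordGE_zero.mp (mem_ordGE_of_le (h.ord_t ▸ zero_le_one))
  induction N with
  | zero => exact_mod_cast hN
  | succ N ih =>
    refine ih fun x hx ↦ ?_
    rcases eq_or_ne x 0 with rfl | hx0
    · exact zero_mem _
    rcases (le_ord_of_mem hx hx0).eq_or_lt' with heq | hlt
    · obtain ⟨c, hc, -, hxc⟩ := h.exists_leadingCoeff hx0
      rw [heq, zpow_natCast] at hxc
      have hct : c * t ^ N ∈ valSpan v k L := Submodule.smul_mem _ (⟨c, hc⟩ : k)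
        (Submodule.subset_span ⟨pow_mem ht N, pow_mem htv N⟩)
      exact sub_add_cancel x (c * t ^ N) ▸ add_mem (hN (by exact_mod_cast hxc)) hct
    · exact hN (mem_ordGE_of_le (by push_cast; omega))

theorem isConductorExponent_zero_of_t_mem (ht : t ∈ L) {N : ℕ}
    (hN : ordGE v N ≤ (valSpan v k L).toAddSubgroup) :
    IsConductorExponent v (valSpan v k L).toAddSubgroup 0 := by
  refine fun s ↦ ⟨fun hs ↦ ?_, fun hs ↦
    (ordGE_anti hs).trans (h.integer_le_valSpan_of_t_mem ht hN)⟩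
  have hord : ord v (t ^ s) = s := by rw [ord_zpow, h.ord_t, mul_one]
  have hmem := h.mem_integer_of_mem_valSpan (hs (mem_ordGE_of_le hord.ge))
  exact hord ▸ le_ord_of_mem (mem_ordGE_zero.mpr hmem) (zpow_ne_zero s h.t_ne_zero)

theorem ord_derivation_eq_zero_of_t_mem {D : Derivation (powField E p) E E} (hD : D t = 1)
    (ht : t ∈ L) (hη : IsGenerator p v L η) : ord v (D η) = 0 := by
  have htv : t ∈ v.integer := mem_ordGE_zero.mp (mem_ordGE_of_le (h.ord_t ▸ zero_le_one))
  obtain ⟨y, -, hy, hDt⟩ := hη.exists_derivation_eq D ht htv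
  rw [hD] at hDt
  have hy0 := left_ne_zero_of_mul (hDt ▸ one_ne_zero)
  have hη0 := right_ne_zero_of_mul (hDt ▸ one_ne_zero)
  have hsum := congrArg (ord v) hDt
  rw [ord_one, ord_mul hy0 hη0] at hsum
  have hynonneg := le_ord_of_mem (mem_ordGE_zero.mpr hy) hy0
  have hηnonneg := le_ord_of_mem
    (mem_ordGE_zero.mpr (h.derivation_mem_integer hD hη.mem_integer)) hη0
  omega

theorem exists_isGenerator_of_pow_mem (hL : Descends k L) {n : ℕ} (hn : n ≠ 0) (ht : t ^ n ∈ L)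
    {N : ℕ} (hN : ordGE v N ≤ (valSpan v k L).toAddSubgroup) : ∃ η, IsGenerator p v L η := by
  refine h.exists_isGenerator hL ⟨_, ht, ?_⟩ fun _ hx ↦ hN hx
  rw [ord_pow, h.ord_t]
  positivity

/-- Taking `p`-th roots of `L` lowers the exponent in `t ^ p ^ n ∈ L`, so that `n` steps lead to a
field containing `t`, where the orders of conductor and different vanish. -/
theorem exists_ord_eq_conductor_add {D : Derivation (powField E p) E E} (hD : D t = 1) {n : ℕ}
    (hL : Descends k L) (ht : t ^ p ^ n ∈ L) {N : ℕ}
    (hN : ordGE v N ≤ (valSpan v k L).toAddSubgroup) :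
    ∃ c η r, IsConductorExponent v (valSpan v k L).toAddSubgroup c ∧ IsGenerator p v L η ∧
      r ∈ L ∧ r ∈ v.integer ∧ r ≠ 0 ∧ ord v r = c + ord v (D η) := by
  have hp0 := (Fact.out : p.Prime).ne_zero
  induction n generalizing L with
  | zero =>
    obtain ⟨η, hη⟩ := h.exists_isGenerator_of_pow_mem hL (pow_ne_zero _ hp0) ht hN
    rw [pow_zero, pow_one] at ht
    exact ⟨0, η, 1, h.isConductorExponent_zero_of_t_mem ht hN, hη, one_mem L, one_mem _,
      one_ne_zero, by rw [ord_one, h.ord_derivation_eq_zero_of_t_mem hD ht hη, zero_add]⟩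
  | succ n ih =>
    obtain ⟨η, hη⟩ := h.exists_isGenerator_of_pow_mem hL (pow_ne_zero _ hp0) ht hN
    obtain ⟨c, η', r, hc, hη', hrL, hr, hr0, hord⟩ := ih (hL.rootField h.exists_root)
      (by rwa [mem_rootField, ← pow_mul, ← pow_succ])
      (hN.trans (valSpan_mono (le_rootField L)))
    obtain ⟨y, hyL, hy, hDη⟩ :=
      hη'.exists_derivation_eq D (le_rootField L hη.mem) hη.mem_integer
    have hDη0 := h.derivation_ne_zero hD hη.notMem_powField
    have hy0 := left_ne_zero_of_mul (hDη ▸ hDη0)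
    have hordDη : ord v (D η) = ord v y + ord v (D η') := by
      rw [hDη, ord_mul hy0 (right_ne_zero_of_mul (hDη ▸ hDη0))]
    refine ⟨_, η, (r * y) ^ p, h.isConductorExponent_of_rootField hD hη hc, hη, mul_mem hrL hyL,
      pow_mem (mul_mem hr hy) p, pow_ne_zero p (mul_ne_zero hr0 hy0), ?_⟩
    rw [ord_pow, ord_mul hr0 hy0, hord, hordDη]
    ring

end IsCurveVal

end ConductorFormula

section FractionValuation

open IsDiscreteValuationRing
open scoped WithZero

variable (B E : Type*) [CommRing B] [IsDomain B] [IsDiscreteValuationRing B] [Field E]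
  [Algebra B E] [IsFractionRing B E]

/-- The normalized valuation of the field of fractions `E` of a discrete valuation ring `B`. -/
noncomputable abbrev fracVal : Valuation E ℤᵐ⁰ :=
  (IsDiscreteValuationRing.maximalIdeal B).valuation E

variable {B E}

theorem mem_integer_fracVal {x : E} :
    x ∈ (fracVal B E).integer ↔ ∃ b : B, algebraMap B E b = x := by
  refine ⟨fun hx ↦ exists_lift_of_le_one hx, ?_⟩
  rintro ⟨b, rfl⟩
  exact (IsDiscreteValuationRing.maximalIdeal B).valuation_le_one b

theorem algebraMap_mem_integer_fracVal (b : B) : algebraMap B E b ∈ (fracVal B E).integer :=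
  mem_integer_fracVal.mpr ⟨b, rfl⟩

theorem ord_algebraMap_unit (u : Bˣ) : ord (fracVal B E) (algebraMap B E u) = 0 := by
  have nonneg (w : Bˣ) : 0 ≤ ord (fracVal B E) (algebraMap B E w) :=
    le_ord_of_mem (mem_ordGE_zero.mpr (algebraMap_mem_integer_fracVal (w : B))) (by simp)
  have hinv := nonneg u⁻¹
  rw [map_units_inv, ord_inv] at hinv
  exact le_antisymm (neg_nonneg.mp hinv) (nonneg u)

theorem ord_algebraMap_irreducible {ϖ : B} (hϖ : Irreducible ϖ) :
    ord (fracVal B E) (algebraMap B E ϖ) = 1 := by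
  rw [ord, IsDedekindDomain.HeightOneSpectrum.valuation_of_algebraMap,
    IsDedekindDomain.HeightOneSpectrum.intValuation_singleton _ hϖ.ne_zero hϖ.maximalIdeal_eq]
  simp

theorem exists_addVal_eq_and_ord_eq {b : B} (hb : b ≠ 0) :
    ∃ n : ℕ, addVal B b = n ∧ ord (fracVal B E) (algebraMap B E b) = n := by
  obtain ⟨ϖ, hϖ⟩ := exists_irreducible B
  obtain ⟨n, u, rfl⟩ := eq_unit_mul_pow_irreducible hb hϖ
  refine ⟨n, addVal_def' u hϖ n, ?_⟩
  rw [map_mul, map_pow, ord_mul (by simp) (pow_ne_zero _ (by simpa using hϖ.ne_zero)), ord_pow,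
    ord_algebraMap_unit, ord_algebraMap_irreducible hϖ, zero_add, mul_one]

theorem addVal_eq_iff {b : B} {n : ℕ} :
    addVal B b = n ↔ b ≠ 0 ∧ ord (fracVal B E) (algebraMap B E b) = n := by
  rcases eq_or_ne b 0 with rfl | hb
  · simp
  obtain ⟨m, hm, hord⟩ := exists_addVal_eq_and_ord_eq (E := E) hb
  simp [hm, hord, hb]

theorem mem_span_pow_iff {ϖ : B} (hϖ : Irreducible ϖ) {b : B} {n : ℕ} :
    b ∈ Ideal.span {ϖ ^ n} ↔ algebraMap B E b ∈ ordGE (fracVal B E) n := by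
  rcases eq_or_ne b 0 with rfl | hb
  · simp
  obtain ⟨m, hm, hord⟩ := exists_addVal_eq_and_ord_eq (E := E) hb
  rw [Ideal.mem_span_singleton, mem_ordGE, ← addVal_le_iff_dvd, hϖ.addVal_pow, hm, hord]
  simp [hb]

end FractionValuation

section Conductor

open IsDiscreteValuationRing

variable {k A B E : Type u} [Field k] [CommRing A] [CommRing B] [IsDomain B]
  [IsDiscreteValuationRing B] [Field E] [Algebra A B] [Algebra B E] [IsFractionRing B E]
  [Algebra A E] [IsScalarTower A B E]

theorem mem_valueSemigroup_iff {n : ℕ} : n ∈ valueSemigroup A B ↔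
    ∃ a : A, algebraMap A E a ≠ 0 ∧ ord (fracVal B E) (algebraMap A E a) = n := by
  refine exists_congr fun a ↦ ?_
  rw [addVal_eq_iff (E := E), IsScalarTower.algebraMap_apply A B E]
  simp

theorem exists_eq_algebraMap_add_mul [Algebra k B]
    (hres : Function.Surjective (algebraMap k (IsLocalRing.ResidueField B))) {ϖ : B}
    (hϖ : Irreducible ϖ) (b : B) : ∃ c : k, ∃ b' : B, b = algebraMap k B c + ϖ * b' := by
  obtain ⟨c, hc⟩ := hres (IsLocalRing.residue B b)
  have hmem : b - algebraMap k B c ∈ IsLocalRing.maximalIdeal B := by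
    rw [← IsLocalRing.residue_eq_zero_iff, map_sub, ← hc, sub_eq_zero]
    rfl
  rw [hϖ.maximalIdeal_eq, Ideal.mem_span_singleton] at hmem
  obtain ⟨b', hb'⟩ := hmem
  exact ⟨c, b', by rw [← hb', add_sub_cancel]⟩

namespace IsConductorExponent

variable {c : ℕ} (hc : IsConductorExponent (fracVal B E) (algebraMap A E).range.toAddSubgroup c)
include hc

theorem mem_valueSemigroup {n : ℕ} (hn : c ≤ n) : n ∈ valueSemigroup A B := by
  obtain ⟨ϖ, hϖ⟩ := exists_irreducible B
  have hord : ord (fracVal B E) (algebraMap B E ϖ ^ n) = n := by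
    rw [ord_pow, ord_algebraMap_irreducible hϖ, mul_one]
  obtain ⟨a, ha⟩ := (hc n).mpr (by exact_mod_cast hn) (mem_ordGE_of_le hord.ge)
  exact mem_valueSemigroup_iff.mpr
    ⟨a, ha ▸ pow_ne_zero n (by simpa using hϖ.ne_zero), ha ▸ hord⟩

/-- If `a ∈ A` had order `c - 1`, then every `x` of order at least `c - 1` would differ from a
scalar multiple of `a` by an element of order at least `c`, hence would lie in `A`. -/
theorem sub_one_notMem_valueSemigroup [Algebra k A] [Algebra k B] [IsScalarTower k A B]
    (hres : Function.Surjective (algebraMap k (IsLocalRing.ResidueField B))) (hpos : 0 < c) :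
    c - 1 ∉ valueSemigroup A B := by
  rw [mem_valueSemigroup_iff (E := E)]
  rintro ⟨a, ha0, hord⟩
  obtain ⟨ϖ, hϖ⟩ := exists_irreducible B
  suffices (c : ℤ) ≤ (c - 1 : ℕ) by lia
  refine (hc _).mp fun x hx ↦ ?_
  have hquot : x * (algebraMap A E a)⁻¹ ∈ (fracVal B E).integer := by
    rw [← mem_ordGE_zero]
    simpa [ord_inv, hord] using mul_mem_ordGE hx
      (mem_ordGE_of_le (x := (algebraMap A E a)⁻¹) (n := -((c - 1 : ℕ) : ℤ))
        (by rw [ord_inv, hord]))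
  obtain ⟨b, hb⟩ := mem_integer_fracVal.mp hquot
  obtain ⟨d, b', rfl⟩ := exists_eq_algebraMap_add_mul hres hϖ b
  have hrem : algebraMap B E (ϖ * b') * algebraMap A E a ∈ ordGE (fracVal B E) c := by
    have hϖb' : algebraMap B E (ϖ * b') ∈ ordGE (fracVal B E) 1 := by
      simpa using (mem_span_pow_iff (E := E) hϖ (n := 1)).mp
        (Ideal.mul_mem_right b' _ (by simp))
    exact ordGE_anti (by lia) (mul_mem_ordGE hϖb' (mem_ordGE_of_le hord.ge))
  have hx' : x = algebraMap A E (algebraMap k A d * a) +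
      algebraMap B E (ϖ * b') * algebraMap A E a := by
    rw [map_mul, IsScalarTower.algebraMap_apply A B E (algebraMap k A d),
      ← IsScalarTower.algebraMap_apply k A B, ← add_mul, ← map_add, hb, inv_mul_cancel_right₀ ha0]
  rw [hx']
  exact add_mem ⟨_, rfl⟩ ((hc c).mpr le_rfl hrem)

theorem finite_compl_valueSemigroup : (valueSemigroup A B)ᶜ.Finite :=
  (Set.finite_Iio c).subset fun n hn ↦ by
    by_contra h
    exact hn (hc.mem_valueSemigroup (by simpa using h))

theorem conductor_eq [Algebra k A] [Algebra k B] [IsScalarTower k A B]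
    (hres : Function.Surjective (algebraMap k (IsLocalRing.ResidueField B))) :
    conductor A B = c := by
  unfold conductor semigroupConductor
  rcases Nat.eq_zero_or_pos c with rfl | hpos
  · have hempty : {d | 0 < d ∧ d ∈ valueSemigroup A B ∧ d - 1 ∉ valueSemigroup A B} = ∅ :=
      Set.eq_empty_iff_forall_notMem.mpr fun n hn ↦ hn.2.2 (hc.mem_valueSemigroup (Nat.zero_le _))
    rw [hempty, csSup_empty, bot_eq_zero]
  · refine IsGreatest.csSup_eq ⟨⟨hpos, hc.mem_valueSemigroup le_rfl,
      hc.sub_one_notMem_valueSemigroup hres hpos⟩, fun n hn ↦ ?_⟩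
    by_contra h
    exact hn.2.2 (hc.mem_valueSemigroup (by lia))

end IsConductorExponent

theorem IsConductorExponent.nonneg {c : ℤ}
    (hc : IsConductorExponent (fracVal B E) (algebraMap A E).range.toAddSubgroup c) : 0 ≤ c := by
  obtain ⟨ϖ, hϖ⟩ := exists_irreducible B
  have hord : ord (fracVal B E) (algebraMap B E ϖ ^ c) = c := by
    rw [ord_zpow, ord_algebraMap_irreducible hϖ, mul_one]
  obtain ⟨a, ha⟩ := (hc c).mpr le_rfl (mem_ordGE_of_le hord.ge)
  have hint : algebraMap B E ϖ ^ c ∈ ordGE (fracVal B E) 0 := by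
    rw [mem_ordGE_zero, ← ha, IsScalarTower.algebraMap_apply A B E]
    exact algebraMap_mem_integer_fracVal _
  exact hord ▸ le_ord_of_mem hint (zpow_ne_zero c (by simpa using hϖ.ne_zero))

end Conductor

section Colength

section LinearMap

variable {S V W X : Type*} [Ring S] [AddCommGroup V] [AddCommGroup W] [AddCommGroup X]
  [Module S V] [Module S W] [Module S X]

theorem length_quotient_range_comp (f : V →ₗ[S] W) (g : W →ₗ[S] X) (hg : Function.Injective g) :
    Module.length S (X ⧸ LinearMap.range (g ∘ₗ f)) =
      Module.length S (W ⧸ LinearMap.range f) + Module.length S (X ⧸ LinearMap.range g) := by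
  have hle : LinearMap.range f ≤ (LinearMap.range (g ∘ₗ f)).comap g := by
    rintro _ ⟨x, rfl⟩
    exact ⟨x, rfl⟩
  refine Module.length_eq_add_of_exact (Submodule.mapQ _ _ g hle)
    (Submodule.factor (LinearMap.range_comp_le_range f g)) ?_ (Submodule.factor_surjective _) ?_
  · rw [← LinearMap.ker_eq_bot, Submodule.ker_mapQ, LinearMap.range_comp,
      Submodule.comap_map_eq_of_injective hg, Submodule.mkQ_map_self]
  · rw [LinearMap.exact_iff, Submodule.range_mapQ, Submodule.factor, Submodule.ker_mapQ,
      Submodule.comap_id]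

theorem length_quotient_range_eq {i : V →ₗ[S] W} (hi : Function.Injective i) {f : V →ₗ[S] V}
    {g : W →ₗ[S] W} (hg : Function.Injective g) (hcomm : g ∘ₗ i = i ∘ₗ f)
    (hfin : Module.length S (W ⧸ LinearMap.range i) ≠ ⊤) :
    Module.length S (V ⧸ LinearMap.range f) = Module.length S (W ⧸ LinearMap.range g) := by
  have h := length_quotient_range_comp i g hg
  rw [hcomm, length_quotient_range_comp f i hi, add_comm] at h
  exact WithTop.add_left_cancel hfin h

end LinearMap

variable (k : Type*) {A B : Type*} [Field k] [CommRing A] [CommRing B] [Algebra k A] [Algebra k B]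

theorem length_quotient_span_singleton (a : A) : Module.length k (A ⧸ Ideal.span {a}) =
    Module.length k (A ⧸ LinearMap.range (LinearMap.mulLeft k a)) := by
  have : LinearMap.range (LinearMap.mulLeft k a) = (Ideal.span {a}).restrictScalars k := by
    ext b
    simp [Ideal.mem_span_singleton, dvd_def, eq_comm]
  rw [this]
  rfl

theorem length_quotient_span_mul [IsDomain B] {a b : B} (ha : a ≠ 0) :
    Module.length k (B ⧸ Ideal.span {a * b}) =
      Module.length k (B ⧸ Ideal.span {a}) + Module.length k (B ⧸ Ideal.span {b}) := by
  rw [length_quotient_span_singleton, length_quotient_span_singleton,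
    length_quotient_span_singleton, LinearMap.mulLeft_mul, add_comm]
  exact length_quotient_range_comp _ _ (mul_right_injective₀ ha)

open IsDiscreteValuationRing in
theorem length_quotient_span_eq_addVal [IsDomain B] [IsDiscreteValuationRing B]
    (hres : Function.Surjective (algebraMap k (IsLocalRing.ResidueField B))) {b : B} (hb : b ≠ 0) :
    Module.length k (B ⧸ Ideal.span {b}) = addVal B b := by
  obtain ⟨ϖ, hϖ⟩ := exists_irreducible B
  have hlenϖ : Module.length k (B ⧸ Ideal.span {ϖ}) = 1 := by
    rw [← hϖ.maximalIdeal_eq]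
    exact (LinearEquiv.ofBijective (Algebra.linearMap k (IsLocalRing.ResidueField B))
      ⟨RingHom.injective _, hres⟩).length_eq.symm.trans (Module.length_eq_one k k)
  have hlenpow (n : ℕ) : Module.length k (B ⧸ Ideal.span {ϖ ^ n}) = n := by
    induction n with
    | zero => simp
    | succ n ih =>
      rw [pow_succ, length_quotient_span_mul k (pow_ne_zero n hϖ.ne_zero), ih, hlenϖ,
        Nat.cast_succ]
  obtain ⟨n, hn⟩ := associated_pow_irreducible hb hϖ
  rw [Ideal.span_singleton_eq_span_singleton.mpr hn, hlenpow,
    (addVal_eq_iff_associated _ _).mpr hn, hϖ.addVal_pow]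

theorem length_quotient_span_eq_of_finite [IsDomain B] [Algebra A B] [IsScalarTower k A B]
    (hinj : Function.Injective (algebraMap A B)) {a : A} (ha : a ≠ 0)
    (hfin : Module.length k (B ⧸ LinearMap.range (IsScalarTower.toAlgHom k A B).toLinearMap) ≠ ⊤) :
    Module.length k (A ⧸ Ideal.span {a}) =
      Module.length k (B ⧸ Ideal.span {algebraMap A B a}) := by
  rw [length_quotient_span_singleton, length_quotient_span_singleton]
  refine length_quotient_range_eq (i := (IsScalarTower.toAlgHom k A B).toLinearMap) hinj
    (mul_right_injective₀ ((map_ne_zero_iff _ hinj).mpr ha)) ?_ hfin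
  ext x
  simp

end Colength

section Differentials

section Ring

variable {A B : Type*} [CommRing A] [CommRing B] [Algebra A B] {p : ℕ} [CharP B p] {t : B}
  {d : Derivation ℤ B B}

theorem derivation_pow_char {S M : Type*} [CommRing S] [Algebra S B] [AddCommGroup M] [Module B M]
    [Module S M] (δ : Derivation S B M) (x : B) : δ (x ^ p) = 0 := by
  rw [Derivation.leibniz_pow, ← Nat.cast_smul_eq_nsmul B, CharP.cast_eq_zero, zero_smul]

theorem kaehlerDifferential_D_eq_smul (hdt : d t = 1)
    (hgen : Algebra.adjoin ℤ (insert t (Set.range fun b : B ↦ b ^ p)) = ⊤) (b : B) :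
    KaehlerDifferential.D A B b = d b • KaehlerDifferential.D A B t := by
  have h : Set.EqOn ((KaehlerDifferential.D A B).restrictScalars ℤ)
      ((LinearMap.toSpanSingleton B _ (KaehlerDifferential.D A B t)).compDer d)
      (insert t (Set.range fun b : B ↦ b ^ p)) := by
    rintro _ (rfl | ⟨x, rfl⟩)
    · simp [hdt]
    · exact (derivation_pow_char _ x).trans (derivation_pow_char _ x).symm
  exact Derivation.eqOn_adjoin h (hgen ▸ trivial)

variable (A) in
/-- The ideal of `B` generated by the derivatives of the elements of `A`. -/
def derivationIdeal (d : Derivation ℤ B B) : Ideal B :=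
  Ideal.span (Set.range fun a : A ↦ d (algebraMap A B a))

variable (A) in
/-- The `A`-linear derivation of `B` into the quotient by `derivationIdeal A d` induced by `d`. -/
def quotientDerivation (d : Derivation ℤ B B) : Derivation A B (B ⧸ derivationIdeal A d) :=
  Derivation.mk'
    { toFun := fun b ↦ Ideal.Quotient.mk _ (d b)
      map_add' := fun x y ↦ by rw [map_add, map_add]
      map_smul' := fun a x ↦ by
        have ha : Ideal.Quotient.mk (derivationIdeal A d) (d (algebraMap A B a)) = 0 :=
          Ideal.Quotient.eq_zero_iff_mem.mpr (Ideal.subset_span ⟨a, rfl⟩)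
        rw [Algebra.smul_def, Derivation.leibniz, smul_eq_mul, smul_eq_mul, map_add,
          map_mul _ x, ha, mul_zero, add_zero, ← Algebra.smul_def]
        rfl }
    fun x y ↦ by
      simp only [LinearMap.coe_mk, AddHom.coe_mk, Derivation.leibniz, map_add]
      rfl

theorem ker_toSpanSingleton_kaehlerDifferential_D (hdt : d t = 1)
    (hgen : Algebra.adjoin ℤ (insert t (Set.range fun b : B ↦ b ^ p)) = ⊤) :
    LinearMap.ker (LinearMap.toSpanSingleton B _ (KaehlerDifferential.D A B t)) =
      derivationIdeal A d := by
  refine le_antisymm (fun b hb ↦ ?_) (Ideal.span_le.mpr ?_)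
  · have h := congrArg (quotientDerivation A d).liftKaehlerDifferential (LinearMap.mem_ker.mp hb)
    rw [LinearMap.toSpanSingleton_apply, map_smul, Derivation.liftKaehlerDifferential_comp_D,
      map_zero] at h
    rw [← Ideal.Quotient.eq_zero_iff_mem, ← h]
    change _ = b • Ideal.Quotient.mk _ (d t)
    rw [hdt, map_one, Algebra.smul_def, mul_one]
    rfl
  · rintro _ ⟨a, rfl⟩
    simp [← kaehlerDifferential_D_eq_smul hdt hgen]

theorem range_toSpanSingleton_kaehlerDifferential_D (hdt : d t = 1)
    (hgen : Algebra.adjoin ℤ (insert t (Set.range fun b : B ↦ b ^ p)) = ⊤) :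
    LinearMap.range (LinearMap.toSpanSingleton B _ (KaehlerDifferential.D A B t)) = ⊤ := by
  rw [eq_top_iff, ← KaehlerDifferential.span_range_derivation, Submodule.span_le]
  rintro _ ⟨b, rfl⟩
  exact ⟨d b, (kaehlerDifferential_D_eq_smul hdt hgen b).symm⟩

end Ring

/-- The cokernel of `α` is the module of relative differentials, which is cyclic. -/
theorem length_cokerAlpha {k A B : Type u} [Field k] [CommRing A] [CommRing B] [Algebra k A]
    [Algebra k B] [Algebra A B] [IsScalarTower k A B] {p : ℕ} [CharP B p] {t : B}
    {d : Derivation ℤ B B} (hdt : d t = 1)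
    (hgen : Algebra.adjoin ℤ (insert t (Set.range fun b : B ↦ b ^ p)) = ⊤) :
    Module.length k (CokerAlpha k A B) = Module.length k (B ⧸ derivationIdeal A d) := by
  have ecoker : CokerAlpha k A B ≃ₗ[B] Ω[B⁄A] :=
    (Submodule.quotEquivOfEq _ _ (KaehlerDifferential.range_mapBaseChange k A B)).trans
      ((KaehlerDifferential.map k A B B).quotKerEquivOfSurjective
        (KaehlerDifferential.map_surjective k A B))
  have ecyclic : (B ⧸ derivationIdeal A d) ≃ₗ[B] Ω[B⁄A] :=
    (Submodule.quotEquivOfEq _ _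
      (ker_toSpanSingleton_kaehlerDifferential_D hdt hgen).symm).trans
      (LinearMap.quotKerEquivOfSurjective _
        (LinearMap.range_eq_top.mp (range_toSpanSingleton_kaehlerDifferential_D hdt hgen)))
  exact ((ecoker.trans ecyclic.symm).restrictScalars k).length_eq

section FractionField

variable {B E : Type*} [CommRing B] [IsDomain B] [IsDiscreteValuationRing B] [Field E]
  [Algebra B E] [IsFractionRing B E] {p : ℕ} [Fact p.Prime] [CharP E p] {K : Subfield E} {t : B}

theorem IsCurveVal.mem_ordGE_zero_of_pow_mul (h : IsCurveVal p (fracVal B E) K (algebraMap B E t))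
    {w : E} {a : ℕ} (ha : a < p) (hw : w ^ p * algebraMap B E t ^ a ∈ ordGE (fracVal B E) 0) :
    w ∈ ordGE (fracVal B E) 0 := by
  refine mem_ordGE.mpr fun hw0 ↦ ?_
  have hle := le_ord_of_mem hw (mul_ne_zero (pow_ne_zero p hw0) (pow_ne_zero a h.t_ne_zero))
  rw [ord_mul (pow_ne_zero p hw0) (pow_ne_zero a h.t_ne_zero), ord_pow, ord_pow, h.ord_t,
    mul_one] at hle
  by_contra! hneg
  have hp : (p : ℤ) * ord (fracVal B E) w ≤ p * (-1) :=
    mul_le_mul_of_nonneg_left (by lia) (Nat.cast_nonneg p)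
  lia

theorem IsCurveVal.adjoin_eq_top (h : IsCurveVal p (fracVal B E) K (algebraMap B E t)) :
    Algebra.adjoin ℤ (insert t (Set.range fun b : B ↦ b ^ p)) = ⊤ := by
  refine eq_top_iff.mpr fun b _ ↦ ?_
  obtain ⟨u, hu, hsum, hmem⟩ := h.exists_eq_sum_mul_pow_t
    (mem_ordGE_zero.mpr (algebraMap_mem_integer_fracVal (E := E) b))
  choose w hw using fun a ↦ (mem_powField p).mp (hu a)
  have hwB (a : ℕ) : ∃ b : B, a < p → algebraMap B E b = w a := by
    by_cases ha : a < p
    · obtain ⟨b, hb⟩ := mem_integer_fracVal.mp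
        (mem_ordGE_zero.mp (h.mem_ordGE_zero_of_pow_mul ha ((hw a).symm ▸ hmem a ha)))
      exact ⟨b, fun _ ↦ hb⟩
    · exact ⟨0, fun h ↦ absurd h ha⟩
  choose w' hw' using hwB
  have hb : b = ∑ a ∈ Finset.range p, w' a ^ p * t ^ a := by
    refine IsFractionRing.injective B E ?_
    rw [hsum, map_sum]
    refine Finset.sum_congr rfl fun a ha ↦ ?_
    rw [map_mul, map_pow, map_pow, hw' a (Finset.mem_range.mp ha), hw]
  rw [hb]
  exact sum_mem fun a _ ↦ mul_mem (Algebra.subset_adjoin (Or.inr ⟨w' a, rfl⟩))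
    (pow_mem (Algebra.subset_adjoin (Set.mem_insert _ _)) a)

theorem exists_derivation_algebraMap_eq {S : Type*} [CommRing S] [Algebra S E]
    {D : Derivation S E E} (hD : ∀ b : B, D (algebraMap B E b) ∈ (fracVal B E).integer) :
    ∃ d : Derivation ℤ B B, ∀ b, algebraMap B E (d b) = D (algebraMap B E b) := by
  choose d hd using fun b ↦ mem_integer_fracVal.mp (hD b)
  have hinj : Function.Injective (algebraMap B E) := IsFractionRing.injective B E
  refine ⟨Derivation.mk' (AddMonoidHom.mk' d fun x y ↦ hinj (by simp [hd])).toIntLinearMap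
    fun x y ↦ hinj ?_, hd⟩
  simp [hd]

end FractionField

end Differentials

section FiniteNormalization

theorem finite_of_finite_comp_of_injective {R S T : Type*} [CommRing R] [CommRing S] [CommRing T]
    [IsNoetherianRing R] (f : R →+* S) (g : S →+* T) (hg : Function.Injective g)
    (h : (g.comp f).Finite) : f.Finite := by
  algebraize [f, g, g.comp f]
  exact Module.Finite.of_injective (IsScalarTower.toAlgHom R S T).toLinearMap hg

theorem finite_iterateFrobenius {R : Type*} [CommRing R] {p : ℕ} [ExpChar R p]
    (h : (frobenius R p).Finite) (n : ℕ) : (iterateFrobenius R p n).Finite := by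
  induction n with
  | zero => rw [iterateFrobenius_zero]; exact RingHom.Finite.id R
  | succ n ih =>
    have hcomp : iterateFrobenius R p (n + 1) = (iterateFrobenius R p n).comp (frobenius R p) := by
      ext x
      simp [iterateFrobenius_add_apply]
    rw [hcomp]
    exact ih.comp h

theorem finite_frobenius_mvPolynomial {k : Type*} [CommRing k] (p : ℕ) [Fact p.Prime] [CharP k p]
    [PerfectRing k p] {σ : Type*} [Finite σ] : (frobenius (MvPolynomial σ k) p).Finite := by
  apply RingHom.IsIntegral.to_finite
  · intro x
    refine ⟨Polynomial.X ^ p - Polynomial.C x,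
      Polynomial.monic_X_pow_sub_C _ (Fact.out : p.Prime).ne_zero, ?_⟩
    simp [frobenius_def]
  · let := (frobenius (MvPolynomial σ k) p).toAlgebra
    refine ⟨Subalgebra.fg_def.mpr ⟨_, Set.finite_range MvPolynomial.X, eq_top_iff.mpr ?_⟩⟩
    intro f _
    induction f using MvPolynomial.induction_on with
    | C c =>
      obtain ⟨d, rfl⟩ := surjective_frobenius k p c
      rw [MvPolynomial.C.map_frobenius]
      exact Subalgebra.algebraMap_mem _ (MvPolynomial.C d)
    | add f g hf hg => exact add_mem (hf trivial) (hg trivial)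
    | mul_X f i hf => exact mul_mem (hf trivial) (Algebra.subset_adjoin ⟨i, rfl⟩)

/- A high power of Frobenius maps `E` into the separable closure `S` of `F` in `E`, and the integral
closure of `P` in `S` is finite because `S` is separable. -/
theorem finite_integralClosure_of_finite_frobenius (P F : Type*) {E : Type*} [CommRing P]
    [IsDomain P] [IsNoetherianRing P] [IsIntegrallyClosed P] (p : ℕ) [Fact p.Prime] [CharP P p]
    [Field F] [Algebra P F] [IsFractionRing P F] [Field E] [Algebra P E] [Algebra F E]
    [IsScalarTower P F E] [FiniteDimensional F E] (hP : (frobenius P p).Finite) :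
    Module.Finite P (integralClosure P E) := by
  have : CharP F p := charP_of_injective_algebraMap (IsFractionRing.injective P F) p
  let S := separableClosure F E
  have : CharP S p := charP_of_injective_algebraMap (algebraMap F S).injective p
  have : ExpChar S p := .prime Fact.out
  have : IsScalarTower P S E := .of_algebraMap_eq fun _ ↦ rfl
  have : Module.Finite P (integralClosure P S) :=
    IsIntegralClosure.finite P F S (integralClosure P S)
  let n := IsPurelyInseparable.exponent S E
  let φ : E →+* S := IsPurelyInseparable.iterateFrobenius S E p le_rfl
  have hφ (x : E) : algebraMap S E (φ x) = x ^ p ^ n :=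
    IsPurelyInseparable.algebraMap_iterateFrobenius S p le_rfl x
  have hφ_integral (x : integralClosure P E) : φ x ∈ integralClosure P S := by
    rw [mem_integralClosure_iff, ← isIntegral_algebraMap_iff (B := E) (algebraMap S E).injective,
      hφ]
    exact x.2.pow _
  let ψ : integralClosure P E →+* integralClosure P S :=
    (φ.comp (algebraMap _ E)).codRestrict (integralClosure P S) hφ_integral
  have hψ : Function.Injective ψ := fun x y h ↦
    Subtype.ext (φ.injective (congrArg Subtype.val h))
  have hcomp : ψ.comp (algebraMap P (integralClosure P E)) =
      (algebraMap P (integralClosure P S)).comp (iterateFrobenius P p n) := by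
    refine RingHom.ext fun x ↦ Subtype.ext ((algebraMap S E).injective ?_)
    change algebraMap S E (φ (algebraMap P E x)) =
      algebraMap S E (algebraMap P S (iterateFrobenius P p n x))
    rw [hφ, ← IsScalarTower.algebraMap_apply, iterateFrobenius_def, map_pow]
  refine RingHom.finite_algebraMap.mp (finite_of_finite_comp_of_injective _ ψ hψ ?_)
  rw [hcomp]
  exact (RingHom.finite_algebraMap.mpr this).comp (finite_iterateFrobenius hP n)

attribute [local instance] FractionRing.liftAlgebra in
theorem finite_integralClosure_mvPolynomial {k : Type*} [Field k] (p : ℕ) [Fact p.Prime]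
    [CharP k p] [PerfectRing k p] {E : Type*} [Field E] [Algebra k E] [Algebra.EssFiniteType k E]
    {σ : Type*} [Finite σ] [Algebra (MvPolynomial σ k) E] [IsScalarTower k (MvPolynomial σ k) E]
    [FaithfulSMul (MvPolynomial σ k) E] [Algebra.IsAlgebraic (MvPolynomial σ k) E] :
    Module.Finite (MvPolynomial σ k) (integralClosure (MvPolynomial σ k) E) := by
  have : IsScalarTower k (FractionRing (MvPolynomial σ k)) E := .to₁₃₄ k (MvPolynomial σ k) _ E
  have : Algebra.EssFiniteType (FractionRing (MvPolynomial σ k)) E := .of_comp k _ E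
  have : Algebra.IsAlgebraic (FractionRing (MvPolynomial σ k)) E :=
    (IsFractionRing.comap_isAlgebraic_iff (A := MvPolynomial σ k)).mp inferInstance
  have : FiniteDimensional (FractionRing (MvPolynomial σ k)) E :=
    Algebra.finite_of_essFiniteType_of_isAlgebraic
  exact finite_integralClosure_of_finite_frobenius _ (FractionRing (MvPolynomial σ k)) p
    (finite_frobenius_mvPolynomial p)

theorem exists_mul_mem_of_finite_integralClosure {P O E : Type*} [CommRing P] [CommRing O]
    [Field E] [Algebra P O] [Algebra O E] [Algebra P E] [IsScalarTower P O E]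
    [IsFractionRing O E] [Module.Finite P (integralClosure P E)] :
    ∃ b ∈ nonZeroDivisors O, ∀ x : E, IsIntegral P x → algebraMap O E b * x ∈
      (algebraMap O E).range := by
  classical
  obtain ⟨σ, hσ⟩ := (inferInstance : Module.Finite P (integralClosure P E)).fg_top
  obtain ⟨b, hb⟩ := IsLocalization.exist_integer_multiples_of_finset (nonZeroDivisors O)
    (σ.image Subtype.val)
  refine ⟨b, b.2, fun x hx ↦ ?_⟩
  let N : Submodule P E := (Algebra.linearMap O E).range.restrictScalars P
  have hspan : Submodule.span P (σ : Set (integralClosure P E)) ≤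
      N.comap (LinearMap.mulLeft P (algebraMap O E b) ∘ₗ (integralClosure P E).val.toLinearMap) :=
    Submodule.span_le.mpr fun y hy ↦ by
      obtain ⟨o, ho⟩ := hb y (Finset.mem_image_of_mem _ hy)
      exact ⟨o, ho.trans (Algebra.smul_def _ _)⟩
  exact (hσ ▸ hspan) (Submodule.mem_top (x := (⟨x, hx⟩ : integralClosure P E)))

theorem isFractionRing_of_isLocalization_of_le_nonZeroDivisors {O A E : Type*} [CommRing O]
    [CommRing A] [Field E] [Algebra O A] [Algebra A E] [Algebra O E] [IsScalarTower O A E]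
    (M : Submonoid O) [IsLocalization M A] [IsFractionRing A E] (hM : M ≤ nonZeroDivisors O) :
    IsFractionRing O E := by
  have hinj : Function.Injective (algebraMap O E) := by
    rw [IsScalarTower.algebraMap_eq O A E]
    exact (IsFractionRing.injective A E).comp (IsLocalization.injective A hM)
  have := (faithfulSMul_iff_algebraMap_injective O E).mpr hinj
  refine IsFractionRing.of_field O E fun z ↦ ?_
  have hdiv (a : A) : ∃ o m : O, algebraMap A E a = algebraMap O E o / algebraMap O E m := by
    obtain ⟨⟨o, m⟩, ho⟩ := IsLocalization.surj M a
    refine ⟨o, m, eq_div_of_mul_eq ?_ ?_⟩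
    · rw [IsScalarTower.algebraMap_apply O A E]
      exact ((IsLocalization.map_units A m).map (algebraMap A E)).ne_zero
    · rw [IsScalarTower.algebraMap_apply O A E, ← map_mul, ho, ← IsScalarTower.algebraMap_apply]
  obtain ⟨a, b, -, rfl⟩ := IsFractionRing.div_surjective (A := A) z
  obtain ⟨o₁, m₁, h₁⟩ := hdiv a
  obtain ⟨o₂, m₂, h₂⟩ := hdiv b
  exact ⟨o₁ * m₂, m₁ * o₂, by rw [h₁, h₂, div_div_div_eq, map_mul, map_mul]⟩

variable {k E : Type*} [Field k] [Field E]

theorem exists_conductor_of_finiteType [Algebra k E] (p : ℕ) [Fact p.Prime] [CharP k p]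
    [PerfectRing k p] (O : Type*) [CommRing O] [Algebra k O] [Algebra.FiniteType k O] [Algebra O E]
    [IsScalarTower k O E] [IsFractionRing O E] :
    ∃ b ∈ nonZeroDivisors O, ∀ x : E, IsIntegral O x → algebraMap O E b * x ∈
      (algebraMap O E).range := by
  have : IsDomain O := (IsFractionRing.injective O E).isDomain (algebraMap O E)
  obtain ⟨s, φ, hφi, hφ⟩ := exists_finite_inj_algHom_of_fg k O
  let P := MvPolynomial (Fin s) k
  let : Algebra P O := φ.toRingHom.toAlgebra
  let : Algebra P E := ((algebraMap O E).comp φ.toRingHom).toAlgebra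
  have : IsScalarTower P O E := .of_algebraMap_eq fun _ ↦ rfl
  have : IsScalarTower k P O := .of_algebraMap_eq fun x ↦ (φ.commutes x).symm
  have : IsScalarTower k P E := .to₁₂₄ k P O E
  have : FaithfulSMul P E := (faithfulSMul_iff_algebraMap_injective P E).mpr
    ((IsFractionRing.injective O E).comp hφi)
  have : Module.Finite P O := hφ
  have : Algebra.IsAlgebraic O E := IsLocalization.isAlgebraic E (nonZeroDivisors O)
  have : Algebra.IsAlgebraic P E := Algebra.IsAlgebraic.trans P O E
  have : Algebra.EssFiniteType O E := .of_isLocalization E (nonZeroDivisors O)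
  have : Algebra.EssFiniteType k E := .comp k O E
  have : Module.Finite P (integralClosure P E) := finite_integralClosure_mvPolynomial p (k := k)
  obtain ⟨b, hb, hmul⟩ := exists_mul_mem_of_finite_integralClosure (P := P) (O := O) (E := E)
  exact ⟨b, hb, fun x hx ↦ hmul x (isIntegral_trans (A := O) _ hx)⟩

theorem exists_conductor [Algebra k E] (p : ℕ) [Fact p.Prime] [CharP k p] [PerfectRing k p]
    {A : Type*} [CommRing A] [IsDomain A] [Algebra k A] [Algebra.EssFiniteType k A] [Algebra A E]
    [IsScalarTower k A E] [IsFractionRing A E] :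
    ∃ g : A, g ≠ 0 ∧ ∀ x : E, IsIntegral A x → algebraMap A E g * x ∈ (algebraMap A E).range := by
  let O := Algebra.EssFiniteType.subalgebra k A
  let M := Algebra.EssFiniteType.submonoid k A
  have hM : M ≤ nonZeroDivisors O := fun x hx ↦
    mem_nonZeroDivisors_of_ne_zero fun h0 ↦ (show IsUnit (algebraMap O A x) from hx).ne_zero
      (by rw [h0, map_zero])
  have : IsFractionRing O E := isFractionRing_of_isLocalization_of_le_nonZeroDivisors (A := A) M hM
  obtain ⟨b, hb, hmul⟩ := exists_conductor_of_finiteType (k := k) (E := E) p O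
  have hb0 : (b : A) ≠ 0 := fun h0 ↦ nonZeroDivisors.ne_zero hb (Subtype.ext h0)
  refine ⟨b, hb0, fun x hx ↦ ?_⟩
  obtain ⟨m, hm⟩ := IsIntegral.exists_multiple_integral_of_isLocalization M x hx
  obtain ⟨o, ho⟩ := hmul (m • x) hm
  obtain ⟨u, hu⟩ : IsUnit (algebraMap O A m) := m.2
  have hmx : m • x = algebraMap A E u * x := by
    rw [Submonoid.smul_def, Algebra.smul_def, IsScalarTower.algebraMap_apply O A E, hu]
  have hunit : algebraMap A E (u⁻¹ : Aˣ) * algebraMap A E u = 1 := by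
    rw [← map_mul, Units.inv_mul, map_one]
  refine ⟨(u⁻¹ : Aˣ) * o, ?_⟩
  change algebraMap A E o = algebraMap A E b * (m • x) at ho
  rw [map_mul, ho, hmx]
  linear_combination (algebraMap A E b * x) * hunit

end FiniteNormalization

section PBasis

variable {k : Type*} [Field k] (p : ℕ) [Fact p.Prime] [CharP k p] [PerfectField k]
  {E : Type*} [Field E] [CharP E p] [Algebra k E]

theorem algebraMap_mem_powField (c : k) : algebraMap k E c ∈ powField E p := by
  have : ExpChar k p := .prime Fact.out
  have : PerfectRing k p := PerfectField.toPerfectRing p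
  obtain ⟨d, rfl⟩ := surjective_frobenius k p c
  rw [frobenius_def, map_pow]
  exact pow_mem_powField p _

open IntermediateField in
/- Every `y` is separable over `k(S)`, so that `k(S)(y) = k(S)(y ^ p)`. -/
theorem adjoin_powField_eq_top (S : Set E) [Algebra.IsSeparable (adjoin k S) E] :
    adjoin (powField E p) S = ⊤ := by
  have hle : (adjoin k S).toSubfield ≤ (adjoin (powField E p) S).toSubfield := by
    rw [adjoin_toSubfield, Subfield.closure_le]
    rintro z (⟨c, rfl⟩ | hz)
    · exact algebraMap_mem _ (⟨_, algebraMap_mem_powField p c⟩ : powField E p)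
    · exact subset_adjoin _ S hz
  refine eq_top_iff.mpr fun y _ ↦ ?_
  have : CharP (adjoin k S) p :=
    charP_of_injective_algebraMap (algebraMap k (adjoin k S)).injective p
  have : ExpChar (adjoin k S) p := .prime Fact.out
  have hy : y ∈ (adjoin (adjoin k S) {y ^ p}).toSubfield :=
    adjoin_simple_eq_adjoin_pow_expChar_of_isSeparable' (adjoin k S) E y p ▸
      mem_adjoin_simple_self (adjoin k S) y
  rw [adjoin_toSubfield] at hy
  change y ∈ (adjoin (powField E p) S).toSubfield
  refine Subfield.closure_le.mpr ?_ hy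
  rintro z (⟨c, rfl⟩ | rfl)
  · exact hle c.2
  · exact algebraMap_mem _ (⟨_, pow_mem_powField p y⟩ : powField E p)

omit [PerfectField k] [CharP k p] [Algebra k E] in
open IntermediateField Polynomial in
theorem finrank_powField_le_of_adjoin_eq_top {x : E} (htop : adjoin (powField E p) {x} = ⊤) :
    Module.Finite (powField E p) E ∧ Module.finrank (powField E p) E ≤ p := by
  let a : powField E p := ⟨x ^ p, pow_mem_powField p x⟩
  have hmonic : (X ^ p - C a).Monic := monic_X_pow_sub_C a (Fact.out : p.Prime).ne_zero
  have hroot : aeval x (X ^ p - C a) = 0 := by simp [a, Algebra.algebraMap_eq_smul_one,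
    Subfield.smul_def]
  have hint : IsIntegral (powField E p) x := ⟨_, hmonic, hroot⟩
  have hfinite := adjoin.finiteDimensional hint
  have hfinrank := adjoin.finrank hint
  rw [htop] at hfinite hfinrank
  have e := (topEquiv (F := powField E p) (E := E)).toLinearEquiv
  refine ⟨Module.Finite.equiv e, ?_⟩
  rw [← e.finrank_eq, hfinrank]
  exact (natDegree_le_natDegree (minpoly.min _ _ hmonic hroot)).trans natDegree_X_pow_sub_C.le

theorem finrank_powField_le [Algebra.EssFiniteType k E] (htr : Algebra.trdeg k E = 1) :
    Module.Finite (powField E p) E ∧ Module.finrank (powField E p) E ≤ p := by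
  obtain ⟨s, hs, hsep⟩ := exists_isTranscendenceBasis_and_isSeparable_of_perfectField k E
  have hcard : s.card = 1 := by simpa [htr] using hs.cardinalMk_eq_trdeg
  obtain ⟨x, rfl⟩ := Finset.card_eq_one.mp hcard
  have htop := adjoin_powField_eq_top (k := k) p (({x} : Finset E) : Set E)
  exact finrank_powField_le_of_adjoin_eq_top p (by simpa using htop)

end PBasis

section ConstantExtension

section FracSubfield

variable (R E : Type*) [CommRing R] [Field E] [Algebra R E]

/-- The field of fractions of (the image of) `R` inside the field `E`. -/
def fracSubfield : Subfield E := Subfield.closure (algebraMap R E).range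

variable {R E}

theorem mem_fracSubfield {x : E} :
    x ∈ fracSubfield R E ↔ ∃ r s : R, algebraMap R E r / algebraMap R E s = x := by
  simp only [fracSubfield, Subfield.mem_closure_iff, Subring.closure_eq, RingHom.mem_range,
    exists_exists_eq_and]

theorem algebraMap_mem_fracSubfield (r : R) : algebraMap R E r ∈ fracSubfield R E :=
  Subfield.subset_closure ⟨r, rfl⟩

theorem mem_fracSubfield_iff_of_isIntegral [IsDomain R] [IsIntegrallyClosed R] [FaithfulSMul R E]
    {x : E} (hx : IsIntegral R x) : x ∈ fracSubfield R E ↔ x ∈ (algebraMap R E).range := by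
  refine ⟨fun hmem ↦ ?_, fun ⟨r, hr⟩ ↦ hr ▸ algebraMap_mem_fracSubfield r⟩
  let φ : FractionRing R →ₐ[R] E :=
    IsFractionRing.liftAlgHom (g := Algebra.ofId R E) (FaithfulSMul.algebraMap_injective R E)
  obtain ⟨r, s, rfl⟩ := mem_fracSubfield.mp hmem
  have hφ : φ (algebraMap R _ r / algebraMap R _ s) = algebraMap R E r / algebraMap R E s := by
    rw [map_div₀, φ.commutes, φ.commutes]
  rw [← hφ] at hx ⊢
  obtain ⟨a, ha⟩ := IsIntegrallyClosed.isIntegral_iff.mp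
    ((isIntegral_algHom_iff φ φ.toRingHom.injective).mp hx)
  exact ⟨a, by rw [← ha, φ.commutes]⟩

end FracSubfield

/-- `A` is obtained from the `K`-algebra `R` by a purely inseparable extension `k` of the field of
constants: it is free over `R` with a basis that comes from a basis of `k` over `K`. -/
structure IsConstantExtension (p : ℕ) (K R k A : Type u) [CommRing K] [CommRing R] [CommRing k]
    [CommRing A] [Algebra K R] [Algebra R A] [Algebra k A] : Prop where
  pow_mem : ∀ a : A, ∃ (n : ℕ) (r : R), algebraMap R A r = a ^ p ^ n
  exists_basis : ∃ (ι : Type u) (b : Module.Basis ι R A) (i₀ : ι), b i₀ = 1 ∧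
    (∀ i, b i ∈ (algebraMap k A).range) ∧
    ∀ (c : k) (i), b.repr (algebraMap k A c) i ∈ (algebraMap K R).range

namespace IsConstantExtension

variable {p : ℕ}

section CommRing

variable {K R k A : Type u} [CommRing K] [CommRing R] [CommRing k] [CommRing A]
  [Algebra K R] [Algebra R A] [Algebra k A] (h : IsConstantExtension p K R k A)
include h

theorem faithfulSMul : FaithfulSMul R A := by
  obtain ⟨ι, b, i₀, -⟩ := h.exists_basis
  exact ⟨fun {r s} hrs ↦ by simpa using congrArg (b.repr · i₀) (hrs (b i₀))⟩

theorem exists_pow_mem_pair (a b : A) : ∃ (n : ℕ) (r s : R),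
    algebraMap R A r = a ^ p ^ n ∧ algebraMap R A s = b ^ p ^ n := by
  obtain ⟨n, r, hr⟩ := h.pow_mem a
  obtain ⟨m, s, hs⟩ := h.pow_mem b
  refine ⟨n + m, r ^ p ^ m, s ^ p ^ n, ?_, ?_⟩
  · rw [map_pow, hr, ← pow_mul, pow_add]
  · rw [map_pow, hs, ← pow_mul, pow_add, mul_comm]

theorem isIntegral [Fact p.Prime] : Algebra.IsIntegral R A := by
  refine ⟨fun a ↦ ?_⟩
  obtain ⟨n, r, hr⟩ := h.pow_mem a
  exact .of_pow (pow_pos (Fact.out : p.Prime).pos n) (hr ▸ isIntegral_algebraMap)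

section FractionField

variable {E : Type u} [Field E] [Algebra A E] [IsFractionRing A E] [Algebra R E]
  [IsScalarTower R A E]

theorem faithfulSMul_fractionField : FaithfulSMul R E := by
  have := h.faithfulSMul
  rw [faithfulSMul_iff_algebraMap_injective, IsScalarTower.algebraMap_eq R A E]
  exact (IsFractionRing.injective A E).comp (FaithfulSMul.algebraMap_injective R A)

omit [Algebra R E] [IsScalarTower R A E] in
theorem isLocalization [Fact p.Prime] [IsDomain R] [IsDomain A] :
    IsLocalization (Algebra.algebraMapSubmonoid A (nonZeroDivisors R)) E := by
  have := h.faithfulSMul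
  have hle : Algebra.algebraMapSubmonoid A (nonZeroDivisors R) ≤ nonZeroDivisors A :=
    map_le_nonZeroDivisors_of_injective _ (FaithfulSMul.algebraMap_injective R A) le_rfl
  refine (IsLocalization.iff_of_le_of_exists_dvd _ (nonZeroDivisors A) hle fun b hb ↦ ?_).mpr
    inferInstance
  obtain ⟨n, r, hr⟩ := h.pow_mem b
  have hr0 : r ≠ 0 := by
    rintro rfl
    exact pow_ne_zero _ (nonZeroDivisors.ne_zero hb) (hr.symm.trans (map_zero _))
  refine ⟨_, ⟨r, mem_nonZeroDivisors_of_ne_zero hr0, rfl⟩, ?_⟩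
  rw [hr]
  exact dvd_pow_self b (pow_ne_zero _ (Fact.out : p.Prime).ne_zero)

theorem exists_pow_eq_div [IsDomain A] (x : E) : ∃ (n : ℕ) (r s : R), algebraMap R E s ≠ 0 ∧
    x ^ p ^ n = algebraMap R E r / algebraMap R E s := by
  obtain ⟨a, b, hb, rfl⟩ := IsFractionRing.div_surjective (A := A) x
  obtain ⟨n, r, s, hr, hs⟩ := h.exists_pow_mem_pair a b
  refine ⟨n, r, s, ?_, ?_⟩
  · rw [IsScalarTower.algebraMap_apply R A E, hs, map_pow]
    exact pow_ne_zero _ (by simpa using nonZeroDivisors.ne_zero hb)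
  · rw [IsScalarTower.algebraMap_apply R A E, hr, IsScalarTower.algebraMap_apply R A E, hs,
      map_pow, map_pow, div_pow]

theorem exists_pow_mem_fracSubfield [IsDomain A] (x : E) :
    ∃ n : ℕ, x ^ p ^ n ∈ fracSubfield R E := by
  obtain ⟨n, r, s, -, hx⟩ := h.exists_pow_eq_div x
  exact ⟨n, mem_fracSubfield.mpr ⟨r, s, hx.symm⟩⟩

end FractionField

end CommRing

section ValSpan

variable {K R k A E : Type u} [Field K] [CommRing R] [Field k] [CommRing A] [Algebra K R]
  [Algebra R A] [Algebra k A] [Field E] [Algebra A E] [Algebra R E] [IsScalarTower R A E]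
  [Algebra k E] [IsScalarTower k A E]

attribute [local instance] FractionRing.liftAlgebra in
theorem descends [Fact p.Prime] [IsDomain R] [IsDomain A] [IsFractionRing A E] [Algebra K k]
    [Algebra K A] [IsScalarTower K k A] [IsScalarTower K R A]
    (h : IsConstantExtension p K R k A) :
    Descends (algebraMap k E).fieldRange (fracSubfield R E) := by
  obtain ⟨ι, b, i₀, hi₀, hk, hrepr⟩ := h.exists_basis
  have := h.isLocalization (E := E)
  have := h.faithfulSMul_fractionField (E := E)
  let bE := b.localizationLocalization (FractionRing R) (nonZeroDivisors R) E
  have hrange : (algebraMap (FractionRing R) E).fieldRange = fracSubfield R E :=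
    IsFractionRing.lift_fieldRange (FaithfulSMul.algebraMap_injective R E)
  let e : FractionRing R ≃+* fracSubfield R E :=
    (algebraMap (FractionRing R) E).rangeRestrictFieldEquiv.trans (.subfieldCongr hrange)
  have he (x) : (e x : E) = algebraMap (FractionRing R) E x := rfl
  let bL := bE.mapCoeffs e fun c x ↦ by
    rw [Subfield.smul_def, he, smul_eq_mul, Algebra.smul_def]
  refine ⟨ι, bL, i₀, ?_, fun i ↦ ?_, ?_⟩
  · simp [bL, bE, hi₀]
  · obtain ⟨c, hc⟩ := hk i
    refine ⟨c, ?_⟩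
    rw [Module.Basis.mapCoeffs_apply, Module.Basis.localizationLocalization_apply, ← hc,
      ← IsScalarTower.algebraMap_apply]
  · rintro _ ⟨c, rfl⟩ i
    obtain ⟨c', hc'⟩ := hrepr c i
    refine ⟨algebraMap K k c', ?_⟩
    have hcoord : bL.repr (algebraMap k E c) i = e (bE.repr (algebraMap k E c) i) := by
      simp [bL, Module.Basis.mapCoeffs]
    rw [hcoord, he, IsScalarTower.algebraMap_apply k A E c,
      Module.Basis.localizationLocalization_repr_algebraMap, ← hc',
      ← IsScalarTower.algebraMap_apply R (FractionRing R) E, IsScalarTower.algebraMap_apply R A E,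
      ← IsScalarTower.algebraMap_apply K R A, IsScalarTower.algebraMap_apply K k A,
      ← IsScalarTower.algebraMap_apply k A E]

open scoped WithZero in
theorem valSpan_toAddSubgroup_eq_range (h : IsConstantExtension p K R k A) {v : Valuation E ℤᵐ⁰}
    (hR : ∀ x ∈ fracSubfield R E, x ∈ v.integer ↔ x ∈ (algebraMap R E).range) :
    (valSpan v (algebraMap k E).fieldRange (fracSubfield R E)).toAddSubgroup =
      (algebraMap A E).range.toAddSubgroup := by
  let N : Submodule (algebraMap k E).fieldRange E :=
    { (algebraMap A E).range.toAddSubmonoid with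
      smul_mem' := by
        rintro ⟨_, c, rfl⟩ _ ⟨a, rfl⟩
        refine ⟨algebraMap k A c * a, ?_⟩
        rw [map_mul, ← IsScalarTower.algebraMap_apply]
        rfl }
  refine le_antisymm (fun x hx ↦ (Submodule.span_le (p := N)).mpr ?_ hx) ?_
  · rintro x ⟨hxL, hxv⟩
    obtain ⟨r, rfl⟩ := (hR x hxL).mp hxv
    exact ⟨algebraMap R A r, (IsScalarTower.algebraMap_apply R A E r).symm⟩
  · rintro _ ⟨a, rfl⟩
    obtain ⟨ι, b, i₀, -, hk, -⟩ := h.exists_basis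
    rw [← b.linearCombination_repr a, Finsupp.linearCombination_apply, Finsupp.sum, map_sum]
    refine Submodule.sum_mem (valSpan v _ _) fun i _ ↦ ?_
    obtain ⟨c, hc⟩ := hk i
    have hr := algebraMap_mem_fracSubfield (E := E) (b.repr a i)
    have hterm : algebraMap A E (b.repr a i • b i) =
        (⟨algebraMap k E c, c, rfl⟩ : (algebraMap k E).fieldRange) •
          algebraMap R E (b.repr a i) := by
      rw [Algebra.smul_def, map_mul, ← hc, ← IsScalarTower.algebraMap_apply,
        ← IsScalarTower.algebraMap_apply, Subfield.smul_def, smul_eq_mul, mul_comm]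
    rw [hterm]
    exact Submodule.smul_mem _ _ (Submodule.subset_span ⟨hr, (hR _ hr).mpr ⟨_, rfl⟩⟩)

end ValSpan

end IsConstantExtension

end ConstantExtension

section Normalization

theorem isNoetherianRing_of_mul_mem_range {A B : Type*} [CommRing A] [IsNoetherianRing A]
    [CommRing B] [IsDomain B] [Algebra A B] {b₀ : B} (hb₀ : b₀ ≠ 0)
    (h : ∀ b : B, b₀ * b ∈ (algebraMap A B).range) : IsNoetherianRing B := by
  let f : B →ₗ[A] LinearMap.range (Algebra.linearMap A B) :=
    (LinearMap.mulLeft A b₀).codRestrict _ h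
  have hf : Function.Injective f := fun x y hxy ↦
    mul_left_cancel₀ hb₀ (congrArg Subtype.val hxy)
  exact isNoetherian_of_tower A (isNoetherian_of_injective f hf)

namespace IsConstantExtension

variable {p : ℕ} [Fact p.Prime] {K R k A B E : Type u} [Field K] [CommRing R] [IsDomain R]
  [Field k] [CommRing A] [IsDomain A] [Algebra K R] [Algebra R A] [Algebra k A] [Field E]
  [Algebra A E] [IsFractionRing A E] [Algebra R E] [IsScalarTower R A E]
  [CommRing B] [Algebra A B] [Algebra B E] [IsScalarTower A B E] [IsIntegralClosure B A E]
  (h : IsConstantExtension p K R k A)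
include h

omit [IsDomain A] in
theorem mem_range_normalization_iff [IsIntegrallyClosed R] {x : E} (hx : x ∈ fracSubfield R E) :
    x ∈ (algebraMap B E).range ↔ x ∈ (algebraMap R E).range := by
  have := h.isIntegral
  have := h.faithfulSMul_fractionField (E := E)
  constructor
  · rintro ⟨b, rfl⟩
    have hb : IsIntegral A (algebraMap B E b) := IsIntegralClosure.isIntegral_iff.mpr ⟨b, rfl⟩
    exact (mem_fracSubfield_iff_of_isIntegral (isIntegral_trans (R := R) _ hb)).mp hx
  · rintro ⟨r, rfl⟩
    exact ⟨algebraMap A B (algebraMap R A r), by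
      rw [← IsScalarTower.algebraMap_apply A B E, ← IsScalarTower.algebraMap_apply R A E]⟩

variable (E) in
include E in
theorem exists_algebraMap_eq_pow [IsIntegrallyClosed R] (b : B) :
    ∃ (n : ℕ) (r : R), algebraMap A B (algebraMap R A r) = b ^ p ^ n := by
  obtain ⟨n, hn⟩ := h.exists_pow_mem_fracSubfield (algebraMap B E b)
  obtain ⟨r, hr⟩ := (h.mem_range_normalization_iff (B := B) hn).mp ⟨b ^ p ^ n, map_pow _ _ _⟩
  refine ⟨n, r, IsIntegralClosure.algebraMap_injective B A E ?_⟩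
  rw [← IsScalarTower.algebraMap_apply A B E, ← IsScalarTower.algebraMap_apply R A E, hr, map_pow]

omit [Algebra A B] [IsScalarTower A B E] in
theorem valuationRing [ValuationRing R] [IsDomain B] [IsFractionRing B E] : ValuationRing B := by
  rw [ValuationRing.iff_isInteger_or_isInteger B E]
  intro x
  obtain ⟨n, r, s, hs, hx⟩ := h.exists_pow_eq_div x
  have isInteger_of_dvd (y : E) (r s : R) (hs : algebraMap R E s ≠ 0)
      (hy : y ^ p ^ n = algebraMap R E r / algebraMap R E s) (hd : s ∣ r) :
      IsLocalization.IsInteger B y := by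
    obtain ⟨u, rfl⟩ := hd
    rw [map_mul, mul_div_cancel_left₀ _ hs, IsScalarTower.algebraMap_apply R A E] at hy
    exact IsIntegralClosure.isIntegral_iff.mp
      (.of_pow (pow_pos (Fact.out : p.Prime).pos n) (hy ▸ isIntegral_algebraMap))
  rcases ValuationRing.dvd_total r s with hd | hd
  · by_cases hr : algebraMap R E r = 0
    · rw [hr, zero_div] at hx
      rw [eq_zero_of_pow_eq_zero hx]
      exact .inl IsLocalization.isInteger_zero
    · exact .inr (isInteger_of_dvd x⁻¹ s r hr (by rw [inv_pow, hx, inv_div]) hd)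
  · exact .inl (isInteger_of_dvd x r s hs hx hd)

omit [IsDomain A] in
variable (E B) in
include E in
theorem isLocalHom_algebraMap_comp [IsIntegrallyClosed R] :
    IsLocalHom ((algebraMap A B).comp (algebraMap R A)) := by
  refine ⟨fun r ⟨u, hu⟩ ↦ ?_⟩
  have := h.faithfulSMul_fractionField (E := E)
  have hr : algebraMap B E u = algebraMap R E r := by
    rw [hu, RingHom.comp_apply, ← IsScalarTower.algebraMap_apply A B E,
      ← IsScalarTower.algebraMap_apply R A E]
  have hinv : algebraMap B E (u⁻¹ : Bˣ) = (algebraMap R E r)⁻¹ := by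
    rw [← hr]
    exact map_units_inv (algebraMap B E) u
  obtain ⟨s, hs⟩ := (h.mem_range_normalization_iff (B := B)
    (inv_mem (algebraMap_mem_fracSubfield r))).mp ⟨_, hinv⟩
  refine IsUnit.of_mul_eq_one s (FaithfulSMul.algebraMap_injective R E ?_)
  rw [map_mul, hs, map_one, mul_inv_cancel₀]
  exact hr ▸ (u.isUnit.map (algebraMap B E)).ne_zero

theorem isDiscreteValuationRing [IsDiscreteValuationRing R] [IsDomain B] [IsFractionRing B E]
    [IsNoetherianRing A] {b₀ : B} (hb₀ : b₀ ≠ 0)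
    (hmul : ∀ b : B, b₀ * b ∈ (algebraMap A B).range) : IsDiscreteValuationRing B := by
  have hval := h.valuationRing (B := B) (E := E)
  have := isNoetherianRing_of_mul_mem_range hb₀ hmul
  have hlocal := h.isLocalHom_algebraMap_comp B E
  have := h.faithfulSMul_fractionField (E := E)
  have hinj : Function.Injective ((algebraMap A B).comp (algebraMap R A)) := by
    refine .of_comp (f := algebraMap B E) ?_
    rw [← RingHom.coe_comp, ← RingHom.comp_assoc, ← IsScalarTower.algebraMap_eq,
      ← IsScalarTower.algebraMap_eq]
    exact FaithfulSMul.algebraMap_injective R E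
  have hfield : ¬IsField B := by
    obtain ⟨ϖ, hϖ⟩ := IsDiscreteValuationRing.exists_irreducible R
    intro hB
    let := hB.toField
    exact hϖ.not_isUnit (hlocal.map_nonunit ϖ
      (isUnit_iff_ne_zero.mpr ((map_ne_zero_iff _ hinj).mpr hϖ.ne_zero)))
  exact ((IsDiscreteValuationRing.TFAE B hfield).out 0 1).mpr hval

variable (E B) in
include E in
/- Some power of a given residue class of `B` comes from `R`, so it is integral over `k`. -/
theorem algebraMap_residueField_surjective [IsIntegrallyClosed R] [IsLocalRing R] [Algebra K k]
    [Algebra K A] [IsScalarTower K k A] [IsScalarTower K R A] [Algebra k B] [IsScalarTower k A B]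
    [IsAlgClosed k] [IsLocalRing B] [Module.Finite K (IsLocalRing.ResidueField R)] :
    Function.Surjective (algebraMap k (IsLocalRing.ResidueField B)) := by
  have := h.isLocalHom_algebraMap_comp B E
  let ρ := IsLocalRing.ResidueField.map ((algebraMap A B).comp (algebraMap R A))
  have hρ : (algebraMap k (IsLocalRing.ResidueField B)).comp (algebraMap K k) =
      ρ.comp (algebraMap K (IsLocalRing.ResidueField R)) := by
    ext c
    rw [RingHom.comp_apply, RingHom.comp_apply,
      IsScalarTower.algebraMap_apply K R (IsLocalRing.ResidueField R),
      IsScalarTower.algebraMap_apply k B (IsLocalRing.ResidueField B),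
      IsScalarTower.algebraMap_apply k A B, ← IsScalarTower.algebraMap_apply K k A,
      IsScalarTower.algebraMap_apply K R A]
    rfl
  have : Algebra.IsIntegral k (IsLocalRing.ResidueField B) := by
    refine ⟨fun x ↦ ?_⟩
    obtain ⟨b, rfl⟩ := IsLocalRing.residue_surjective x
    obtain ⟨n, r, hr⟩ := h.exists_algebraMap_eq_pow E b
    refine .of_pow (pow_pos (Fact.out : p.Prime).pos n) ?_
    rw [← map_pow, ← hr]
    exact (Algebra.IsIntegral.isIntegral (R := K) (IsLocalRing.residue R r)).map_of_comp_eq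
      (algebraMap K k) ρ hρ
  exact IsAlgClosed.algebraMap_bijective_of_isIntegral.2

end IsConstantExtension

end Normalization

section Divisibility

theorem trdeg_eq_of_isAlgebraic (K R k E : Type u) [Field K] [CommRing R] [IsDomain R] [Field k]
    [Field E] [Algebra K R] [Algebra K k] [Algebra K E] [Algebra R E] [Algebra k E]
    [IsScalarTower K R E] [IsScalarTower K k E] [FaithfulSMul R E] [Algebra.IsAlgebraic R E]
    [Algebra.IsAlgebraic K k] : Algebra.trdeg k E = Algebra.trdeg K R := by
  have hk := trdeg_add_eq K k (A := E)
  have hR := trdeg_add_eq K R (A := E)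
  rw [trdeg_eq_zero, zero_add] at hk
  rw [trdeg_eq_zero (R := R), add_zero] at hR
  rw [hk, hR]

theorem finite_and_finrank_eq_of_length_eq {k V : Type*} [Field k] [AddCommGroup V] [Module k V]
    {n : ℕ} (h : Module.length k V = n) : Module.Finite k V ∧ Module.finrank k V = n := by
  have hfin : IsFiniteLength k V := Module.length_ne_top_iff.mp (h ▸ ENat.natCast_ne_top n)
  have := (isFiniteLength_iff_isNoetherian_isArtinian.mp hfin).1
  exact ⟨inferInstance, by exact_mod_cast (Module.length_eq_finrank k V).symm.trans h⟩

open scoped WithZero in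
theorem ord_algebraMap_irreducible_dvd {R E : Type*} [CommRing R] [IsDomain R]
    [IsDiscreteValuationRing R] [Field E] [Algebra R E] [FaithfulSMul R E] {v : Valuation E ℤᵐ⁰}
    (hv : ∀ r, algebraMap R E r ∈ v.integer) {ϖ : R} (hϖ : Irreducible ϖ) (r : R) :
    ord v (algebraMap R E ϖ) ∣ ord v (algebraMap R E r) := by
  rcases eq_or_ne r 0 with rfl | hr
  · simp [ord]
  have hne {s : R} (hs : s ≠ 0) : algebraMap R E s ≠ 0 :=
    (map_ne_zero_iff _ (FaithfulSMul.algebraMap_injective R E)).mpr hs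
  have ord_nonneg (u : Rˣ) : 0 ≤ ord v (algebraMap R E u) :=
    le_ord_of_mem (mem_ordGE_zero.mpr (hv u)) (hne u.ne_zero)
  obtain ⟨n, u, rfl⟩ := IsDiscreteValuationRing.eq_unit_mul_pow_irreducible hr hϖ
  have ord_unit : ord v (algebraMap R E u) = 0 := by
    have hinv := ord_nonneg u⁻¹
    rw [map_units_inv (algebraMap R E), ord_inv] at hinv
    exact le_antisymm (by lia) (ord_nonneg u)
  rw [map_mul, map_pow, ord_mul (hne u.ne_zero) (pow_ne_zero n (hne hϖ.ne_zero)), ord_pow,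
    ord_unit, zero_add]
  exact dvd_mul_left _ _

open scoped WithZero in
theorem IsCurveVal.exists_derivation_eq_of_mem_valSpan {E : Type*} [Field E] {p : ℕ}
    [Fact p.Prime] [CharP E p] {v : Valuation E ℤᵐ⁰} {k L : Subfield E} {t η : E}
    (h : IsCurveVal p v k t) (hη : IsGenerator p v L η) (D : Derivation (powField E p) E E) {x : E}
    (hx : x ∈ valSpan v k L) : ∃ y ∈ v.integer, D x = y * D η := by
  induction hx using Submodule.span_induction with
  | mem x hx =>
    obtain ⟨y, -, hy⟩ := hη.exists_derivation_eq D hx.1 hx.2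
    exact ⟨y, hy⟩
  | zero => exact ⟨0, zero_mem _, by rw [map_zero, zero_mul]⟩
  | add x₁ x₂ _ _ hx₁ hx₂ =>
    obtain ⟨y₁, hy₁, hDx₁⟩ := hx₁
    obtain ⟨y₂, hy₂, hDx₂⟩ := hx₂
    exact ⟨y₁ + y₂, add_mem hy₁ hy₂, by rw [map_add, hDx₁, hDx₂, add_mul]⟩
  | smul c x _ hx =>
    obtain ⟨y, hy, hDx⟩ := hx
    refine ⟨c * y, mul_mem (h.mem_integer c c.2) hy, ?_⟩
    rw [Subfield.smul_def, smul_eq_mul, derivation_powField_mul D (h.mem_powField_of_mem c.2), hDx,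
      mul_assoc]

theorem algebraMap_normalization_injective (A B E : Type*) [CommRing A] [CommRing B] [CommRing E]
    [Algebra A B] [Algebra A E] [Algebra B E] [IsScalarTower A B E] [IsFractionRing A E] :
    Function.Injective (algebraMap A B) := by
  have hAE := IsFractionRing.injective A E
  rw [IsScalarTower.algebraMap_eq A B E] at hAE
  exact .of_comp hAE

section CurveRing

variable {p : ℕ} [Fact p.Prime] {k A B E : Type u} [Field k] [CommRing A] [Algebra k A] [Field E]
  [Algebra A E] [Algebra k E] [IsScalarTower k A E] [CommRing B] [Algebra A B] [Algebra B E]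
  [IsScalarTower A B E]

variable (k B E) (p) in
theorem exists_mul_mem_range_normalization [IsDomain A] [IsFractionRing A E]
    [IsIntegralClosure B A E] [CharP k p] [PerfectRing k p] [Algebra.EssFiniteType k A] :
    ∃ g : A, g ≠ 0 ∧ ∀ b : B, algebraMap A B g * b ∈ (algebraMap A B).range := by
  obtain ⟨g, hg0, hg⟩ := exists_conductor (k := k) (A := A) (E := E) p
  refine ⟨g, hg0, fun b ↦ ?_⟩
  obtain ⟨a, ha⟩ := hg (algebraMap B E b) (IsIntegralClosure.isIntegral_iff.mpr ⟨b, rfl⟩)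
  refine ⟨a, IsIntegralClosure.algebraMap_injective B A E ?_⟩
  rw [map_mul, ← IsScalarTower.algebraMap_apply, ← IsScalarTower.algebraMap_apply, ha]

variable [IsDomain B] [IsDiscreteValuationRing B] [IsFractionRing B E]

theorem ordGE_le_range {g : A} (hg0 : algebraMap A E g ≠ 0)
    (hg : ∀ b : B, algebraMap A B g * b ∈ (algebraMap A B).range) :
    ordGE (fracVal B E) (ord (fracVal B E) (algebraMap A E g)) ≤
      (algebraMap A E).range.toAddSubgroup := by
  intro x hx
  have hquot : (algebraMap A E g)⁻¹ * x ∈ (fracVal B E).integer := by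
    have hinv := mul_mem_ordGE (mem_ordGE_of_le (ord_inv (algebraMap A E g)).ge) hx
    rwa [neg_add_cancel, mem_ordGE_zero] at hinv
  obtain ⟨b, hb⟩ := mem_integer_fracVal.mp hquot
  obtain ⟨a, ha⟩ := hg b
  refine ⟨a, ?_⟩
  rw [IsScalarTower.algebraMap_apply A B E, ha, map_mul, hb, ← IsScalarTower.algebraMap_apply,
    mul_inv_cancel_left₀ hg0]

variable [Algebra k B] [IsScalarTower k A B]

/- Since `g B ⊆ A`, the colength of `A` in `B` is at most that of `g B`. -/
theorem length_quotient_span_eq_addVal_algebraMap (hinj : Function.Injective (algebraMap A B))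
    (hres : Function.Surjective (algebraMap k (IsLocalRing.ResidueField B))) {g : A} (hg0 : g ≠ 0)
    (hg : ∀ b : B, algebraMap A B g * b ∈ (algebraMap A B).range) {a : A} (ha : a ≠ 0) :
    Module.length k (A ⧸ Ideal.span {a}) =
      IsDiscreteValuationRing.addVal B (algebraMap A B a) := by
  have hne {x : A} (hx : x ≠ 0) : algebraMap A B x ≠ 0 := (map_ne_zero_iff _ hinj).mpr hx
  have hle : (Ideal.span {algebraMap A B g}).restrictScalars k ≤
      LinearMap.range (IsScalarTower.toAlgHom k A B).toLinearMap := by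
    intro x hx
    obtain ⟨b, rfl⟩ := Ideal.mem_span_singleton.mp hx
    exact hg b
  have hfin : Module.length k (B ⧸ Ideal.span {algebraMap A B g}) ≠ ⊤ := by
    rw [length_quotient_span_eq_addVal k hres (hne hg0)]
    exact IsDiscreteValuationRing.addVal_eq_top_iff.not.mpr (hne hg0)
  rw [length_quotient_span_eq_of_finite k hinj ha, length_quotient_span_eq_addVal k hres (hne ha)]
  exact ne_top_of_le_ne_top hfin
    (Module.length_le_of_surjective _ (Submodule.factor_surjective hle))

open Algebra in
theorem isCurveVal_fracVal [IsAlgClosed k] [CharP k p] [CharP E p] [EssFiniteType k E]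
    [IsScalarTower k B E] (htr : trdeg k E = 1)
    (hres : Function.Surjective (algebraMap k (IsLocalRing.ResidueField B))) {t : B}
    (ht : Irreducible t) :
    IsCurveVal p (fracVal B E) (algebraMap k E).fieldRange (algebraMap B E t) where
  ord_t := ord_algebraMap_irreducible ht
  mem_integer := by
    rintro _ ⟨c, rfl⟩
    rw [IsScalarTower.algebraMap_apply k B E]
    exact algebraMap_mem_integer_fracVal _
  exists_root := by
    rintro _ ⟨c, rfl⟩
    obtain ⟨d, rfl⟩ := IsAlgClosed.exists_pow_nat_eq c (Fact.out : p.Prime).pos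
    exact ⟨_, ⟨d, rfl⟩, (map_pow _ _ _).symm⟩
  exists_residue x hx := by
    obtain ⟨b, rfl⟩ := mem_integer_fracVal.mp hx
    obtain ⟨c, b', rfl⟩ := exists_eq_algebraMap_add_mul hres ht b
    refine ⟨_, ⟨c, rfl⟩, ?_⟩
    rw [IsScalarTower.algebraMap_apply k B E, map_add, add_sub_cancel_left, mul_comm, map_mul]
    exact integer_mul_mem_ordGE (algebraMap_mem_integer_fracVal b')
      (mem_ordGE_of_le (ord_algebraMap_irreducible ht).ge)
  finite := (finrank_powField_le (k := k) p htr).1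
  finrank_le := (finrank_powField_le (k := k) p htr).2

omit [IsScalarTower k A E] in
/- By `length_cokerAlpha`, the cokernel has the length of `B / (d A) = B / (d η)`. -/
theorem IsCurveVal.exists_length_cokerAlpha_eq_and_ord_eq [CharP E p] {L : Subfield E} {t : B}
    {η : E} {D : Derivation (powField E p) E E}
    (h : IsCurveVal p (fracVal B E) (algebraMap k E).fieldRange (algebraMap B E t))
    (hres : Function.Surjective (algebraMap k (IsLocalRing.ResidueField B)))
    (hA : (valSpan (fracVal B E) (algebraMap k E).fieldRange L).toAddSubgroup =
      (algebraMap A E).range.toAddSubgroup)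
    (hη : IsGenerator p (fracVal B E) L η) (hD : D (algebraMap B E t) = 1) :
    ∃ e : ℕ, Module.length k (CokerAlpha k A B) = e ∧ ord (fracVal B E) (D η) = e := by
  have hinj : Function.Injective (algebraMap B E) := IsFractionRing.injective B E
  have : CharP B p := ((algebraMap B E).charP_iff hinj p).mpr inferInstance
  obtain ⟨d, hd⟩ := exists_derivation_algebraMap_eq fun b ↦
    h.derivation_mem_integer hD (algebraMap_mem_integer_fracVal b)
  have hηA : η ∈ (algebraMap A E).range.toAddSubgroup :=
    hA ▸ Submodule.subset_span ⟨hη.mem, hη.mem_integer⟩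
  obtain ⟨a, rfl⟩ := hηA
  have hda : algebraMap B E (d (algebraMap A B a)) = D (algebraMap A E a) := by
    rw [hd, ← IsScalarTower.algebraMap_apply]
  have hideal : derivationIdeal A d = Ideal.span {d (algebraMap A B a)} := by
    refine le_antisymm (Ideal.span_le.mpr ?_) (Ideal.span_mono ?_)
    · rintro _ ⟨a', rfl⟩
      have ha' : algebraMap A E a' ∈ (algebraMap A E).range.toAddSubgroup := ⟨a', rfl⟩
      obtain ⟨y, hy, hDa'⟩ := h.exists_derivation_eq_of_mem_valSpan hη D (hA ▸ ha')
      obtain ⟨b, rfl⟩ := mem_integer_fracVal.mp hy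
      refine Ideal.mem_span_singleton'.mpr ⟨b, hinj ?_⟩
      rw [map_mul, hda, ← hDa', hd, ← IsScalarTower.algebraMap_apply]
    · exact Set.singleton_subset_iff.mpr ⟨a, rfl⟩
  have hne : d (algebraMap A B a) ≠ 0 := by
    rw [← map_ne_zero_iff _ hinj, hda]
    exact h.derivation_ne_zero hD hη.notMem_powField
  obtain ⟨e, he, hord⟩ := exists_addVal_eq_and_ord_eq (E := E) hne
  refine ⟨e, ?_, hda ▸ hord⟩
  rw [length_cokerAlpha (hinj (by rw [hd, hD, map_one])) h.adjoin_eq_top, hideal,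
    length_quotient_span_eq_addVal k hres hne, he]

end CurveRing

namespace IsConstantExtension

variable {p : ℕ} [Fact p.Prime] {K R k A B E : Type u} [Field K] [CommRing R] [IsDomain R]
  [IsDiscreteValuationRing R] [Field k] [CommRing A] [IsDomain A] [Algebra K R] [Algebra R A]
  [Algebra k A] [Field E] [Algebra A E] [IsFractionRing A E] [Algebra R E] [IsScalarTower R A E]
  [Algebra k E] [IsScalarTower k A E] [CommRing B] [IsDomain B] [Algebra A B] [Algebra B E]
  [IsScalarTower A B E] [IsIntegralClosure B A E] [IsFractionRing B E]
  (h : IsConstantExtension p K R k A)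
include h

variable (B E) in
include E in
theorem isDiscreteValuationRing_of_essFiniteType [IsAlgClosed k] [CharP k p]
    [Algebra.EssFiniteType k A] : IsDiscreteValuationRing B := by
  have := Algebra.EssFiniteType.isNoetherianRing k A
  obtain ⟨g, hg0, hg⟩ := exists_mul_mem_range_normalization p k (A := A) B E
  exact h.isDiscreteValuationRing (E := E)
    ((map_ne_zero_iff _ (algebraMap_normalization_injective A B E)).mpr hg0) hg

variable [Algebra K k] [Algebra K A] [IsScalarTower K k A] [IsScalarTower K R A]

theorem trdeg_fractionField [Algebra.IsAlgebraic K k] : Algebra.trdeg k E = Algebra.trdeg K R := by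
  let : Algebra K E := ((algebraMap A E).comp (algebraMap K A)).toAlgebra
  have : IsScalarTower K A E := .of_algebraMap_eq' rfl
  have : IsScalarTower K R E := .to₁₂₄ K R A E
  have : IsScalarTower K k E := .to₁₂₄ K k A E
  have := h.isIntegral
  have := h.faithfulSMul
  have := h.faithfulSMul_fractionField (E := E)
  have : Algebra.IsAlgebraic A E := IsLocalization.isAlgebraic E (nonZeroDivisors A)
  have : Algebra.IsAlgebraic R E := .trans R A E
  exact trdeg_eq_of_isAlgebraic K R k E

variable [IsDiscreteValuationRing B] [IsAlgClosed k] [CharP k p] [Algebra.EssFiniteType k A]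
  [Algebra k B] [IsScalarTower k A B] [Module.Finite K (IsLocalRing.ResidueField R)]

theorem ord_eq_of_length_eq {ϖ : R} (hϖ : ϖ ≠ 0) {n : ℕ}
    (hn : Module.length k (A ⧸ Ideal.span {algebraMap R A ϖ}) = n) :
    ord (fracVal B E) (algebraMap R E ϖ) = n := by
  have := h.faithfulSMul
  have hinj := algebraMap_normalization_injective A B E
  obtain ⟨g, hg0, hg⟩ := exists_mul_mem_range_normalization p k (A := A) B E
  rw [length_quotient_span_eq_addVal_algebraMap hinj (h.algebraMap_residueField_surjective B E)
    hg0 hg ((map_ne_zero_iff _ (FaithfulSMul.algebraMap_injective R A)).mpr hϖ)] at hn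
  rw [IsScalarTower.algebraMap_apply R A E, IsScalarTower.algebraMap_apply A B E]
  exact (addVal_eq_iff.mp hn).2

theorem exists_ord_eq_conductor_add_finrank [Algebra.IsAlgebraic K k]
    (htr : Algebra.trdeg K R = 1) : (valueSemigroup A B)ᶜ.Finite ∧
      Module.Finite k (CokerAlpha k A B) ∧ ∃ r : R, ord (fracVal B E) (algebraMap R E r) =
        conductor A B + Module.finrank k (CokerAlpha k A B) := by
  have : Algebra.EssFiniteType A E := .of_isLocalization E (nonZeroDivisors A)
  have : Algebra.EssFiniteType k E := .comp k A E
  have : CharP E p := charP_of_injective_algebraMap (algebraMap k E).injective p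
  have : IsScalarTower k B E := .to₁₃₄ k A B E
  have hres := h.algebraMap_residueField_surjective B E
  obtain ⟨t, ht⟩ := IsDiscreteValuationRing.exists_irreducible B
  have hval := isCurveVal_fracVal (p := p) (k := k) (B := B) (E := E)
    (h.trdeg_fractionField.trans htr) hres ht
  obtain ⟨D, hD⟩ := exists_derivation_apply_eq_one hval.finrank_powField hval.t_notMem_powField
  obtain ⟨n, hn⟩ := h.exists_pow_mem_fracSubfield (algebraMap B E t)
  have hR (x : E) (hx : x ∈ fracSubfield R E) :
      x ∈ (fracVal B E).integer ↔ x ∈ (algebraMap R E).range :=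
    mem_integer_fracVal.trans (h.mem_range_normalization_iff hx)
  have hA := h.valSpan_toAddSubgroup_eq_range hR
  obtain ⟨g, hg0, hg⟩ := exists_mul_mem_range_normalization p k (A := A) B E
  have hN := (ordGE_anti (Int.self_le_toNat _)).trans <| hA ▸
    ordGE_le_range ((map_ne_zero_iff _ (IsFractionRing.injective A E)).mpr hg0) hg
  obtain ⟨c, η, r, hc, hη, hrL, hr0, hrne, hr⟩ :=
    hval.exists_ord_eq_conductor_add hD h.descends hn hN
  rw [hA] at hc
  lift c to ℕ using hc.nonneg
  obtain ⟨e, he, hord⟩ := hval.exists_length_cokerAlpha_eq_and_ord_eq hres hA hη hD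
  obtain ⟨hfin, hfinrank⟩ := finite_and_finrank_eq_of_length_eq he
  obtain ⟨r, rfl⟩ := (hR r hrL).mp hr0
  exact ⟨hc.finite_compl_valueSemigroup, hfin, r, by rw [hr, hord, hc.conductor_eq hres, hfinrank]⟩

variable (B E) in
include E in
theorem finrank_residueField_dvd [Algebra.IsAlgebraic K k] (htr : Algebra.trdeg K R = 1)
    (hlen : ∀ ϖ : R, Irreducible ϖ → Module.length k (A ⧸ Ideal.span {algebraMap R A ϖ}) =
      Module.finrank K (IsLocalRing.ResidueField R)) :
    (valueSemigroup A B)ᶜ.Finite ∧ Module.Finite k (CokerAlpha k A B) ∧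
      (Module.finrank K (IsLocalRing.ResidueField R) : ℤ) ∣
        conductor A B + diffDegree k A B - 1 := by
  have := h.faithfulSMul_fractionField (E := E)
  obtain ⟨hgaps, hfin, r, hr⟩ := h.exists_ord_eq_conductor_add_finrank (B := B) (E := E) htr
  obtain ⟨ϖ, hϖ⟩ := IsDiscreteValuationRing.exists_irreducible R
  have hint (s : R) : algebraMap R E s ∈ (fracVal B E).integer := by
    rw [IsScalarTower.algebraMap_apply R A E, IsScalarTower.algebraMap_apply A B E]
    exact algebraMap_mem_integer_fracVal _
  have hdvd := ord_algebraMap_irreducible_dvd hint hϖ r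
  rw [h.ord_eq_of_length_eq hϖ.ne_zero (hlen ϖ hϖ), hr] at hdvd
  refine ⟨hgaps, hfin, ?_⟩
  convert hdvd using 1
  rw [diffDegree]
  push_cast
  ring
end IsConstantExtension

end Divisibility

section Geometric

attribute [local instance] Algebra.TensorProduct.rightAlgebra

section TensorProduct

variable (K R k : Type u) [Field K] [CommRing R] [Algebra K R] [Field k] [Algebra K k]

theorem exists_algebraMap_eq_pow_tensorProduct [Nontrivial R] (p : ℕ) [Fact p.Prime] [CharP K p]
    [IsPurelyInseparable K k] (x : k ⊗[K] R) :
    ∃ (n : ℕ) (r : R), algebraMap R (k ⊗[K] R) r = x ^ p ^ n := by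
  have : ExpChar K p := .prime Fact.out
  have : CharP (k ⊗[K] R) p := charP_of_injective_algebraMap
    (FaithfulSMul.algebraMap_injective K (k ⊗[K] R)) p
  induction x using TensorProduct.induction_on with
  | zero => exact ⟨0, 0, by rw [map_zero, pow_zero, pow_one]⟩
  | tmul c r =>
    obtain ⟨n, d, hd⟩ := IsPurelyInseparable.pow_mem K p c
    refine ⟨n, d • r ^ p ^ n, ?_⟩
    rw [Algebra.TensorProduct.tmul_pow, ← hd, Algebra.algebraMap_eq_smul_one d,
      TensorProduct.smul_tmul]
    rfl
  | add x y hx hy =>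
    have : CharP R p := charP_of_injective_algebraMap (algebraMap K R).injective p
    obtain ⟨n, r, hr⟩ := hx
    obtain ⟨m, s, hs⟩ := hy
    refine ⟨n + m, r ^ p ^ m + s ^ p ^ n, ?_⟩
    rw [add_pow_char_pow, map_add, map_pow, map_pow, hr, hs, ← pow_mul, ← pow_mul, pow_add,
      mul_comm (p ^ m)]

theorem isConstantExtension_tensorProduct [Nontrivial R] (p : ℕ) [Fact p.Prime] [CharP K p]
    [IsPurelyInseparable K k] : IsConstantExtension p K R k (k ⊗[K] R) where
  pow_mem := exists_algebraMap_eq_pow_tensorProduct K R k p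
  exists_basis := by
    have hli : LinearIndepOn K id ({1} : Set k) := .singleton one_ne_zero
    let b := Module.Basis.extend hli
    have hb (i) : b i = i := Module.Basis.extend_apply_self hli i
    refine ⟨_, (Algebra.TensorProduct.basis R b).map
      (Algebra.TensorProduct.commRight K R k).toLinearEquiv,
      ⟨1, Module.Basis.subset_extend hli rfl⟩, ?_, fun i ↦ ⟨b i, ?_⟩, fun c i ↦ ⟨b.repr c i, ?_⟩⟩
    · simp [hb, Algebra.TensorProduct.one_def]
    · simp
    · simp [Algebra.TensorProduct.basis_repr_tmul]

theorem length_tensorProduct_quotient_span (a : R) [Module.Finite K (R ⧸ Ideal.span {a})] :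
    Module.length k ((k ⊗[K] R) ⧸ Ideal.span {algebraMap R (k ⊗[K] R) a}) =
      Module.finrank K (R ⧸ Ideal.span {a}) := by
  have hmap : (Ideal.span {a}).map (Algebra.TensorProduct.includeRight (A := k) (R := K)) =
      Ideal.span {algebraMap R (k ⊗[K] R) a} := by
    rw [Ideal.map_span, Set.image_singleton]
    rfl
  let e := Algebra.TensorProduct.tensorQuotientEquiv (R := K) k R k (Ideal.span {a})
  rw [← hmap, ← e.toLinearEquiv.length_eq, Module.length_eq_finrank, Module.finrank_baseChange]

end TensorProduct

theorem finrank_residueField_dvd (p : ℕ) [Fact p.Prime] (K R : Type u) [Field K] [CharP K p]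
    [IsSepClosed K] [CommRing R] [IsDomain R] [IsDiscreteValuationRing R] [Algebra K R]
    [Algebra.EssFiniteType K R] [IsDomain (GeomRing K R)]
    [Module.Finite K (IsLocalRing.ResidueField R)] (htr : Algebra.trdeg K R = 1) :
    ∃ _ : IsDiscreteValuationRing (GeomNormalization K R),
      (valueSemigroup (GeomRing K R) (GeomNormalization K R))ᶜ.Finite ∧
      Module.Finite (AlgebraicClosure K)
        (CokerAlpha (AlgebraicClosure K) (GeomRing K R) (GeomNormalization K R)) ∧
      (Module.finrank K (IsLocalRing.ResidueField R) : ℤ) ∣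
        (conductor (GeomRing K R) (GeomNormalization K R) : ℤ) +
          (diffDegree (AlgebraicClosure K) (GeomRing K R) (GeomNormalization K R) : ℤ) - 1 := by
  have h := isConstantExtension_tensorProduct K R (AlgebraicClosure K) p
  have : CharP (AlgebraicClosure K) p :=
    charP_of_injective_algebraMap (algebraMap K (AlgebraicClosure K)).injective p
  have : Algebra.IsAlgebraic (GeomRing K R) (FractionRing (GeomRing K R)) :=
    IsLocalization.isAlgebraic _ (nonZeroDivisors (GeomRing K R))
  have : IsFractionRing (GeomNormalization K R) (FractionRing (GeomRing K R)) :=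
    integralClosure.isFractionRing_of_algebraic
      fun _ ↦ (IsFractionRing.to_map_eq_zero_iff (K := FractionRing (GeomRing K R))).mp
  have hdvr := h.isDiscreteValuationRing_of_essFiniteType (GeomNormalization K R)
    (FractionRing (GeomRing K R))
  refine ⟨hdvr, h.finrank_residueField_dvd (GeomNormalization K R) (FractionRing (GeomRing K R))
    htr fun ϖ hϖ ↦ ?_⟩
  have : Module.Finite K (R ⧸ Ideal.span {ϖ}) :=
    hϖ.maximalIdeal_eq ▸ inferInstanceAs (Module.Finite K (IsLocalRing.ResidueField R))
  rw [length_tensorProduct_quotient_span, ← hϖ.maximalIdeal_eq]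
  rfl

end Geometric

section Dimension

theorem ringKrullDim_le_of_isIntegral (R S : Type*) [CommRing R] [CommRing S] [Algebra R S]
    [Algebra.IsIntegral R S] [FaithfulSMul R S] : ringKrullDim R ≤ ringKrullDim S := by
  refine iSup_le fun l ↦ ?_
  obtain ⟨P, hP⟩ := Algebra.IsIntegral.comap_surjective R S l.head
  have : P.asIdeal.LiesOver l.head.asIdeal := ⟨by rw [← hP]; rfl⟩
  obtain ⟨L, hL, -⟩ := Ideal.exists_ltSeries_of_hasGoingUp l P.asIdeal
  rw [← hL]
  exact le_iSup (fun l : LTSeries (PrimeSpectrum S) ↦ (l.length : WithBot ℕ∞)) L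

theorem trdeg_eq_one_of_ringKrullDim_le_one (K S : Type u) [Field K] [CommRing S] [IsDomain S]
    [Algebra K S] [Algebra.FiniteType K S] (hdim : ringKrullDim S ≤ 1) (hS : ¬IsField S) :
    Algebra.trdeg K S = 1 := by
  obtain ⟨s, φ, hφi, hφ⟩ := exists_integral_inj_algHom_of_fg K S
  let P := MvPolynomial (Fin s) K
  let : Algebra P S := φ.toRingHom.toAlgebra
  have : IsScalarTower K P S := .of_algebraMap_eq fun x ↦ (φ.commutes x).symm
  have : FaithfulSMul P S := (faithfulSMul_iff_algebraMap_injective P S).mpr hφi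
  have : Algebra.IsIntegral P S := ⟨hφ⟩
  have htr : (s : Cardinal) = Algebra.trdeg K S := by
    simpa [P, trdeg_eq_zero (R := P)] using trdeg_add_eq K P (A := S)
  have hs : s ≤ 1 := by
    have hle := (ringKrullDim_le_of_isIntegral P S).trans hdim
    rw [MvPolynomial.ringKrullDim_of_isNoetherianRing, ringKrullDim_eq_zero_of_field] at hle
    simpa using hle
  have hs0 : s ≠ 0 := by
    rintro rfl
    have : Algebra.IsAlgebraic K S := trdeg_eq_zero_iff.mp (htr ▸ Nat.cast_zero)
    exact hS (isField_of_isIntegral_of_isField' (Field.toIsField K))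
  rw [← htr, le_antisymm hs (Nat.one_le_iff_ne_zero.mpr hs0), Nat.cast_one]

section Localization

variable (K S R : Type u) [Field K] [CommRing S] [Algebra K S] [CommRing R] [Algebra K R]
  [Algebra S R] [IsScalarTower K S R]

theorem trdeg_eq_of_isLocalization {M : Submonoid S} (hM : M ≤ nonZeroDivisors S)
    [IsLocalization M R] [IsDomain S] [IsDomain R] :
    Algebra.trdeg K R = Algebra.trdeg K S := by
  have : FaithfulSMul S R :=
    (faithfulSMul_iff_algebraMap_injective S R).mpr (IsLocalization.injective R hM)
  have : Algebra.IsAlgebraic S R := IsLocalization.isAlgebraic R M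
  rw [← trdeg_add_eq K S (A := R), trdeg_eq_zero (R := S), add_zero]

theorem isDomain_tensorProduct_of_isLocalization (k : Type u) [Field k] [Algebra K k]
    [IsDomain (k ⊗[K] S)] {M : Submonoid S} (hM : M ≤ nonZeroDivisors S) [IsLocalization M R] :
    IsDomain (k ⊗[K] R) := by
  let φ := Algebra.TensorProduct.map (AlgHom.id k k) (IsScalarTower.toAlgHom K S R)
  let : Algebra (k ⊗[K] S) (k ⊗[K] R) := φ.toAlgebra
  have : IsScalarTower k (k ⊗[K] S) (k ⊗[K] R) :=
    .of_algebraMap_eq fun x ↦ (φ.commutes x).symm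
  have hloc := IsLocalization.tensorProduct_tensorProduct_right K k M R <| by
    ext x
    change φ (1 ⊗ₜ x) = _
    simp [φ]
  refine IsLocalization.isDomain_of_le_nonZeroDivisors (R := k ⊗[K] S) (S := k ⊗[K] R)
    (M := M.map (Algebra.TensorProduct.includeRight (R := K) (A := k))) ?_
  exact map_le_nonZeroDivisors_of_injective _
    (Algebra.TensorProduct.includeRight_injective (algebraMap K k).injective) hM

variable {S} (q : Ideal S) [q.IsMaximal] [IsLocalization.AtPrime R q] [IsLocalRing R]

include q in
theorem finite_residueField_of_isMaximal [Algebra.FiniteType K S] :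
    Module.Finite K (IsLocalRing.ResidueField R) := by
  have hsurj : Function.Surjective (IsScalarTower.toAlgHom K S (IsLocalRing.ResidueField R)) := by
    intro x
    obtain ⟨y, rfl⟩ := (IsLocalization.AtPrime.equivQuotMaximalIdeal q R).surjective x
    obtain ⟨z, rfl⟩ := Ideal.Quotient.mk_surjective y
    exact ⟨z, rfl⟩
  have : Algebra.FiniteType K (IsLocalRing.ResidueField R) := .of_surjective _ hsurj
  exact finite_of_finite_type_of_isJacobsonRing K _

end Localization

theorem not_isField_of_isLocalization_atPrime {S : Type*} (R : Type*) [CommRing S] [IsDomain S]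
    [CommRing R] [Algebra S R] (q : Ideal S) [q.IsMaximal] [IsLocalization.AtPrime R q]
    (hS : ¬IsField S) : ¬IsField R := by
  intro hR
  have : IsLocalRing R := IsLocalization.AtPrime.isLocalRing R q
  have hq : q ≠ ⊥ := by
    rintro rfl
    exact hS (Ring.isField_iff_maximal_bot.mpr inferInstance)
  obtain ⟨x, hx, hx0⟩ := Submodule.exists_mem_ne_zero_of_ne_bot hq
  have hinj : Function.Injective (algebraMap S R) :=
    IsLocalization.injective R (Ideal.primeCompl_le_nonZeroDivisors q)
  have hxm := (IsLocalization.AtPrime.to_map_mem_maximal_iff R q x).mpr hx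
  rw [IsLocalRing.isField_iff_maximalIdeal_eq.mp hR, Ideal.mem_bot] at hxm
  exact hx0 (hinj (by rw [hxm, map_zero]))

theorem isDiscreteValuationRing_of_isRegularLocalRing (R : Type*) [CommRing R] [IsDomain R]
    [IsRegularLocalRing R] (hdim : ringKrullDim R ≤ 1) (hR : ¬IsField R) :
    IsDiscreteValuationRing R := by
  rw [← IsRegularLocalRing.spanFinrank_maximalIdeal, Nat.cast_le_one,
    IsLocalRing.spanFinrank_maximalIdeal_eq_finrank_cotangentSpace] at hdim
  have hprincipal : IsPrincipalIdealRing R :=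
    ((tfae_of_isNoetherianRing_of_isLocalRing_of_isDomain R).out 0 5).mpr hdim
  exact { hprincipal with not_a_field' := IsLocalRing.isField_iff_maximalIdeal_eq.not.mp hR }

end Dimension

section Curve

variable {K : Type u} [Field K] {C : Scheme.{u}} (f : C ⟶ Spec (.of K))

section OpenImmersion

variable {S : Type u} [CommRing S] (i : Spec (.of S) ⟶ C) [IsOpenImmersion i]

include i in
theorem isDomain_of_isOpenImmersion [Nontrivial S] [IsIntegral C] : IsDomain S := by
  have : IsIntegral (Spec (.of S)) := isIntegral_of_isOpenImmersion i
  exact (affine_isIntegral_iff (.of S)).mp this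

theorem isDomain_tensorProduct_of_isOpenImmersion [Nontrivial S] [Algebra K S]
    [GeometricallyIntegral f] (hi : i ≫ f = Spec.map (CommRingCat.ofHom (algebraMap K S)))
    (k : Type u) [Field k] [Algebra K k] : IsDomain (k ⊗[K] S) := by
  let y := Spec.map (CommRingCat.ofHom (algebraMap K k))
  have hint : IsIntegral (Limits.pullback y f) :=
    pullback_of_geometrically' GeometricallyIntegral.geometrically_isIntegral k y
  have hpb := (IsPullback.of_hasPullback (Limits.pullback.snd y f) i).paste_horiz
    (IsPullback.of_hasPullback y f)
  rw [hi] at hpb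
  let e := hpb.isoPullback ≪≫ pullbackSpecIso K k S
  have : Nontrivial (k ⊗[K] S) := (Algebra.TensorProduct.includeRight_injective (R := K) (A := k)
    (B := S) (algebraMap K k).injective).nontrivial
  exact isDomain_of_isOpenImmersion
    (e.inv ≫ Limits.pullback.fst (Limits.pullback.snd y f) i)

include i in
theorem ringKrullDim_le_topologicalKrullDim : ringKrullDim S ≤ topologicalKrullDim C := by
  rw [← PrimeSpectrum.topologicalKrullDim_eq_ringKrullDim]
  exact i.isOpenEmbedding.isInducing.topologicalKrullDim_le

theorem not_isField_of_isOpenImmersion [IsIntegral C] (hdim : ¬topologicalKrullDim C ≤ 0)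
    {P : C} (hP : IsClosed ({P} : Set C)) (hPi : P ∈ Set.range i) : ¬IsField S := by
  intro hS
  let := hS.toField
  have hrange : Set.range i = {P} := by
    obtain ⟨x, rfl⟩ := hPi
    exact (Set.range_unique (f := i)).trans (congrArg _ (congrArg i (Subsingleton.elim _ _)))
  have hopen : IsOpen ({P} : Set C) := hrange ▸ i.isOpenEmbedding.isOpen_range
  have huniv : ({P} : Set C) = Set.univ := by
    rw [← hP.closure_eq]
    exact (hopen.dense (Set.singleton_nonempty P)).closure_eq
  have : Subsingleton C := Set.subsingleton_univ_iff.mp (huniv ▸ Set.subsingleton_singleton)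
  exact hdim (topologicalKrullDim_zero_of_discreteTopology C)

end OpenImmersion

section Sections

variable {U : C.Opens}

/-- The structure map `K → Γ(C, U)` of the ring of functions on an open subset of a `K`-scheme. -/
noncomputable def sectionMap (U : C.Opens) : CommRingCat.of K ⟶ Γ(C, U) :=
  (Scheme.ΓSpecIso (.of K)).inv ≫ f.appLE ⊤ U le_top

theorem fromSpec_comp (hU : IsAffineOpen U) : hU.fromSpec ≫ f = Spec.map (sectionMap f U) := by
  rw [← IsAffineOpen.SpecMap_appLE_fromSpec f (isAffineOpen_top _) hU le_top,
    IsAffineOpen.fromSpec_top, Scheme.isoSpec_Spec_inv, sectionMap, Spec.map_comp]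

theorem finiteType_sectionMap (hU : IsAffineOpen U) [LocallyOfFiniteType f] :
    (sectionMap f U).hom.FiniteType := by
  rw [sectionMap, CommRingCat.hom_comp]
  exact (f.finiteType_appLE (isAffineOpen_top _) hU le_top).comp (.of_surjective _
    (Scheme.ΓSpecIso (.of K)).symm.commRingCatIsoToRingEquiv.surjective)

theorem germ_comp_sectionMap {P : C} (hP : P ∈ U) :
    (C.presheaf.germ U P hP).hom.comp (sectionMap f U).hom = structureMap f P := by
  rw [structureMap, sectionMap, ← CommRingCat.hom_comp]
  simp only [Scheme.Hom.appLE, Category.assoc, TopCat.Presheaf.germ_res]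
  rfl

end Sections

variable {f} in
theorem exists_affineChart (P : C) : ∃ (S : Type u) (_ : CommRing S) (_ : Algebra K S)
    (_ : Algebra S (LocalRing f P)) (_ : IsScalarTower K S (LocalRing f P))
    (i : Spec (.of S) ⟶ C) (_ : IsOpenImmersion i) (q : Ideal S) (_ : q.IsPrime)
    (_ : IsLocalization.AtPrime (LocalRing f P) q),
    i ≫ f = Spec.map (CommRingCat.ofHom (algebraMap K S)) ∧ P ∈ Set.range i ∧
      (LocallyOfFiniteType f → Algebra.FiniteType K S) ∧
      (IsClosed ({P} : Set C) → q.IsMaximal) := by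
  obtain ⟨U, hU, hPU, -⟩ := exists_isAffineOpen_mem_and_subset (U := ⊤) (x := P) trivial
  let : Algebra K Γ(C, U) := (sectionMap f U).hom.toAlgebra
  let : Algebra Γ(C, U) (LocalRing f P) := (C.presheaf.germ U P hPU).hom.toAlgebra
  refine ⟨Γ(C, U), inferInstance, inferInstance, inferInstance,
    .of_algebraMap_eq' (germ_comp_sectionMap f hPU).symm, hU.fromSpec,
    inferInstanceAs (IsOpenImmersion hU.fromSpec), (hU.primeIdealOf ⟨P, hPU⟩).asIdeal,
    inferInstance, hU.isLocalization_stalk ⟨P, hPU⟩, fromSpec_comp f hU,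
    hU.range_fromSpec.symm ▸ hPU, fun _ ↦ finiteType_sectionMap f hU,
    hU.primeIdealOf_isMaximal_of_isClosed ⟨P, hPU⟩⟩

section LocalRing

variable (P : C)

instance [IsIntegral C] : IsDomain (LocalRing f P) :=
  inferInstanceAs (IsDomain (C.presheaf.stalk P))

instance [LocallyOfFiniteType f] : Algebra.EssFiniteType K (LocalRing f P) := by
  obtain ⟨S, _, _, _, _, -, -, q, _, _, -, -, hft, -⟩ := exists_affineChart (f := f) P
  have := hft inferInstance
  have : Algebra.EssFiniteType S (LocalRing f P) := .of_isLocalization _ q.primeCompl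
  exact .comp K S _

theorem isDomain_tensorProduct_localRing [GeometricallyIntegral f] (k : Type u) [Field k]
    [Algebra K k] : IsDomain (k ⊗[K] LocalRing f P) := by
  have : IsIntegral C := GeometricallyIntegral.isIntegral_of_subsingleton f
  obtain ⟨S, _, _, _, _, i, _, q, _, _, hi, -⟩ := exists_affineChart (f := f) P
  have : Nontrivial S := (algebraMap S (LocalRing f P)).domain_nontrivial
  have := isDomain_of_isOpenImmersion i
  have := isDomain_tensorProduct_of_isOpenImmersion f i hi k
  exact isDomain_tensorProduct_of_isLocalization K S _ k q.primeCompl_le_nonZeroDivisors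

variable {P} (hP : IsClosed ({P} : Set C))
include hP

theorem finite_residueField_localRing [LocallyOfFiniteType f] :
    Module.Finite K (IsLocalRing.ResidueField (LocalRing f P)) := by
  obtain ⟨S, _, _, _, _, -, -, q, _, _, -, -, hft, hmax⟩ := exists_affineChart (f := f) P
  have := hft inferInstance
  have := hmax hP
  exact finite_residueField_of_isMaximal K _ q

variable [IsIntegral C] (hdim : topologicalKrullDim C = 1)
include hdim

theorem trdeg_localRing [LocallyOfFiniteType f] : Algebra.trdeg K (LocalRing f P) = 1 := by
  obtain ⟨S, _, _, _, _, i, _, q, _, _, -, hPi, hft, -⟩ := exists_affineChart (f := f) P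
  have := hft inferInstance
  have : Nontrivial S := (algebraMap S (LocalRing f P)).domain_nontrivial
  have := isDomain_of_isOpenImmersion i
  rw [trdeg_eq_of_isLocalization K S _ q.primeCompl_le_nonZeroDivisors]
  exact trdeg_eq_one_of_ringKrullDim_le_one K S (hdim ▸ ringKrullDim_le_topologicalKrullDim i)
    (not_isField_of_isOpenImmersion i (by simp [hdim]) hP hPi)

theorem isDiscreteValuationRing_localRing [IsRegularLocalRing (LocalRing f P)] :
    IsDiscreteValuationRing (LocalRing f P) := by
  obtain ⟨S, _, _, _, _, i, _, q, _, _, -, hPi, -, hmax⟩ := exists_affineChart (f := f) P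
  have := hmax hP
  have : Nontrivial S := (algebraMap S (LocalRing f P)).domain_nontrivial
  have := isDomain_of_isOpenImmersion i
  have hdimS : ringKrullDim S ≤ 1 := hdim ▸ ringKrullDim_le_topologicalKrullDim i
  refine isDiscreteValuationRing_of_isRegularLocalRing _ ?_
    (not_isField_of_isLocalization_atPrime _ q
      (not_isField_of_isOpenImmersion i (by simp [hdim]) hP hPi))
  rw [IsLocalization.AtPrime.ringKrullDim_eq_height q]
  exact Ideal.height_le_ringKrullDim_of_isPrime.trans hdimS

end LocalRing

end Curve

end RegularCurve

theorem mainTheorem8_general {K : Type u} [Field K] [IsSepClosed K] (p : ℕ) [Fact p.Prime]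
    [CharP K p] {C : Scheme.{u}} (f : C ⟶ Spec (.of K))
    [LocallyOfFiniteType f] [GeometricallyIntegral f]
    (hdim : topologicalKrullDim C = 1)
    (P : C) (hP : IsClosed ({P} : Set C))
    (hreg : IsRegularLocalRing (RegularCurve.LocalRing f P)) :
    ∃ (_ : IsDomain (RegularCurve.GeomRing K (RegularCurve.LocalRing f P)))
      (_ : IsDiscreteValuationRing
        (RegularCurve.GeomNormalization K (RegularCurve.LocalRing f P))),
      Module.Finite K (IsLocalRing.ResidueField (RegularCurve.LocalRing f P)) ∧
      (RegularCurve.valueSemigroup (RegularCurve.GeomRing K (RegularCurve.LocalRing f P))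
        (RegularCurve.GeomNormalization K (RegularCurve.LocalRing f P)))ᶜ.Finite ∧
      Module.Finite (AlgebraicClosure K)
        (RegularCurve.CokerAlpha (AlgebraicClosure K)
          (RegularCurve.GeomRing K (RegularCurve.LocalRing f P))
          (RegularCurve.GeomNormalization K (RegularCurve.LocalRing f P))) ∧
      (RegularCurve.pointDegree f P : ℤ) ∣
        (RegularCurve.conductor (RegularCurve.GeomRing K (RegularCurve.LocalRing f P))
            (RegularCurve.GeomNormalization K (RegularCurve.LocalRing f P)) : ℤ) +
          (RegularCurve.diffDegree (AlgebraicClosure K)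
            (RegularCurve.GeomRing K (RegularCurve.LocalRing f P))
            (RegularCurve.GeomNormalization K (RegularCurve.LocalRing f P)) : ℤ) - 1 := by
  have : IsIntegral C := GeometricallyIntegral.isIntegral_of_subsingleton f
  have hdom := RegularCurve.isDomain_tensorProduct_localRing f P (AlgebraicClosure K)
  have hfin := RegularCurve.finite_residueField_localRing f hP
  have := RegularCurve.isDiscreteValuationRing_localRing f hP hdim
  obtain ⟨hdvr, hgaps, hcoker, hdvd⟩ :=
    RegularCurve.finrank_residueField_dvd p K (RegularCurve.LocalRing f P)
      (RegularCurve.trdeg_localRing f hP hdim)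
  exact ⟨hdom, hdvr, hfin, hgaps, hcoker, hdvd⟩

/-- `C` is a geometrically integral curve over a separably closed field `K` of characteristic
`p > 0`, and `P` is a closed point at which `C` is regular. The first conjuncts say that the
valuation `ν₀` and the three numbers are well defined; the last one is the divisibility. -/
theorem mainTheorem8 {K : Type u} [Field K] [IsSepClosed K] (p : ℕ) [Fact p.Prime] [CharP K p]
    {C : Scheme.{u}} (f : C ⟶ Spec (.of K))
    [IsSeparated f] [LocallyOfFiniteType f] [QuasiCompact f] [GeometricallyIntegral f]
    (hdim : topologicalKrullDim C = 1)
    (P : C) (hP : IsClosed ({P} : Set C))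
    (hreg : IsRegularLocalRing (RegularCurve.LocalRing f P)) :
    ∃ (_ : IsDomain (RegularCurve.GeomRing K (RegularCurve.LocalRing f P)))
      (_ : IsDiscreteValuationRing
        (RegularCurve.GeomNormalization K (RegularCurve.LocalRing f P))),
      Module.Finite K (IsLocalRing.ResidueField (RegularCurve.LocalRing f P)) ∧
      (RegularCurve.valueSemigroup (RegularCurve.GeomRing K (RegularCurve.LocalRing f P))
        (RegularCurve.GeomNormalization K (RegularCurve.LocalRing f P)))ᶜ.Finite ∧
      Module.Finite (AlgebraicClosure K)
        (RegularCurve.CokerAlpha (AlgebraicClosure K)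
          (RegularCurve.GeomRing K (RegularCurve.LocalRing f P))
          (RegularCurve.GeomNormalization K (RegularCurve.LocalRing f P))) ∧
      (RegularCurve.pointDegree f P : ℤ) ∣
        (RegularCurve.conductor (RegularCurve.GeomRing K (RegularCurve.LocalRing f P))
            (RegularCurve.GeomNormalization K (RegularCurve.LocalRing f P)) : ℤ) +
          (RegularCurve.diffDegree (AlgebraicClosure K)
            (RegularCurve.GeomRing K (RegularCurve.LocalRing f P))
            (RegularCurve.GeomNormalization K (RegularCurve.LocalRing f P)) : ℤ) - 1 :=
  mainTheorem8_general p f hdim P hP hreg
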